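/- Conventions. For a unital ring $R$ let $R^{\times}$ denote its set of regular elements (elements that are neither left nor right zero-divisors). A $P_R$-invariant algebra over $R$ is a family $\mathcal C$ of subsets of $R$ that contains $R$, is closed under finite unions, finite intersections and complements, and satisfies $a+b\cdot X\in\mathcal C$ for all $X\in\mathcal C$, $a\in R$, $b\in R^{\times}$. The reduced ring C*-algebra $\mathfrak A_r[R,\mathcal C]$ is the C*-subalgebra of $\mathcal L(\ell^2(R))$ generated by the operators $E_X\xi_r=1_X(r)\xi_r$ ($X\in\mathcal C$), $U^a\xi_r=\xi_{a+r}$ ($a\in R$) and $S_b\xi_r=\xi_{br}$ ($b\in R^{\times}$), where $(\xi_r)_{r\in R}$ is the canonical orthonormal basis of $\ell^2(R)$. The full ring C*-algebra $\mathfrak A[R,\mathcal C]$ is the universal unital C*-algebra generated by projections $e_X$ ($X\in\mathcal C$), unitaries $u^a$ ($a\in R$) and isometries $s_b$ ($b\in R^{\times}$) satisfying, for all $a,c\in R$, $b,d\in R^{\times}$ and $X,Y\in\mathcal C$, $$u^0=1,\qquad u^a s_b u^c s_d=u^{a+bc}s_{bd},\qquad u^a s_b\, e_X\,(u^a s_b)^*=e_{a+b\cdot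 X},$$ $$e_R=1,\qquad e_Xe_Y=e_{X\cap Y},\qquad e_{X\cup Y}=e_X+e_Y\ \text{ if } X\cap Y=\emptyset .$$ Proposition. Let $R_1,R_2$ be unital rings and let $\mathcal C_i$ be a $P_{R_i}$-invariant algebra over $R_i$ ($i=1,2$). Let $\mathcal C(\mathcal C_1\times\mathcal C_2)$ be the smallest $P_{R_1\times R_2}$-invariant algebra over $R_1\times R_2$ containing all sets $X_1\times X_2$ with $X_i\in\mathcal C_i$. Then there are *-isomorphisms $$\mathfrak A_r[R_1\times R_2,\mathcal C(\mathcal C_1\times\mathcal C_2)]\cong\mathfrak A_r[R_1,\mathcal C_1]\otimes_{\min}\mathfrak A_r[R_2,\mathcal C_2],$$ $$\mathfrak A[R_1\times R_2,\mathcal C(\mathcal C_1\times\mathcal C_2)]\cong\mathfrak A[R_1,\mathcal C_1]\otimes_{\max}\mathfrak A[R_2,\mathcal C_2].$$ Here the minimal tensor product of C*-algebras $A\subseteq\mathcal L(H)$, $B\subseteq\mathcal L(K)$ is the closure of the algebraic tensor product $A\odot B$ in $\mathcal L(H\otimes K)$, and the maximal tensor product of $A$ and $B$ is the completion of $A\odot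 B$ in the largest C*-norm. -/

import Mathlib

open scoped TensorProduct nonZeroDivisors

noncomputable section

/-! ### C*-seminorms and the C*-algebras they define -/

/-- A C*-seminorm on a unital complex *-algebra. -/
structure CStarSeminorm (F : Type*) [Ring F] [StarRing F] [Algebra ℂ F] extends
    Seminorm ℂ F where
  mul_le' : ∀ x y, toFun (x * y) ≤ toFun x * toFun y
  star_mul_self' : ∀ x, toFun (star x * x) = toFun x * toFun x

namespace CStarSeminorm

variable {F : Type*} [Ring F] [StarRing F] [Algebra ℂ F]

instance : CoeFun (CStarSeminorm F) (fun _ => F → ℝ) := ⟨fun p => p.toSeminorm⟩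

theorem mul_le (p : CStarSeminorm F) (x y : F) : p (x * y) ≤ p x * p y := p.mul_le' x y

theorem star_mul_self (p : CStarSeminorm F) (x : F) : p (star x * x) = p x * p x :=
  p.star_mul_self' x

theorem nonneg (p : CStarSeminorm F) (x : F) : 0 ≤ p x := apply_nonneg p.toSeminorm x

theorem add_le (p : CStarSeminorm F) (x y : F) : p (x + y) ≤ p x + p y :=
  map_add_le_add p.toSeminorm x y

theorem smul_eq (p : CStarSeminorm F) (c : ℂ) (x : F) : p (c • x) = ‖c‖ * p x :=
  map_smul_eq_mul p.toSeminorm c x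

theorem le_star (p : CStarSeminorm F) (x : F) : p x ≤ p (star x) := by
  rcases (p.nonneg x).eq_or_lt with h | h
  · rw [← h]; exact p.nonneg _
  · have h1 := p.mul_le (star x) x
    rw [p.star_mul_self] at h1
    exact le_of_mul_le_mul_right h1 h

theorem star_eq (p : CStarSeminorm F) (x : F) : p (star x) = p x :=
  le_antisymm (by simpa using p.le_star (star x)) (p.le_star x)

theorem one_le_one (p : CStarSeminorm F) : p 1 ≤ 1 := by
  have h := p.star_mul_self 1
  rw [star_one, one_mul] at h
  nlinarith [p.nonneg 1]

theorem congr (p : CStarSeminorm F) {x y : F} (h : p (x - y) = 0) : p x = p y := by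
  have h1 := abs_sub_map_le_sub p.toSeminorm x y
  have h2 : |p x - p y| ≤ 0 := h ▸ h1
  exact sub_eq_zero.1 (abs_eq_zero.1 (le_antisymm h2 (abs_nonneg _)))

/-- The *-algebra `F`, equipped with the C*-seminorm `p`. -/
def Pre (_p : CStarSeminorm F) : Type _ := F

section Pre

variable (p : CStarSeminorm F)

instance : Ring p.Pre := inferInstanceAs (Ring F)
instance : StarRing p.Pre := inferInstanceAs (StarRing F)
instance : Algebra ℂ p.Pre := inferInstanceAs (Algebra ℂ F)
instance [StarModule ℂ F] : StarModule ℂ p.Pre := inferInstanceAs (StarModule ℂ F)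

instance : SeminormedRing p.Pre :=
  { (inferInstance : Ring p.Pre) with
    norm := fun x => p x
    dist := fun x y => p (-x + y)
    dist_self := fun x => (congrArg p (neg_add_cancel x)).trans (map_zero p.toSeminorm)
    dist_comm := fun x y => by
      have h : -y + x = -(-x + y) := by abel
      exact (map_neg_eq_map p.toSeminorm (-x + y)).symm.trans (congrArg p h.symm)
    dist_triangle := fun x y z => by
      have h : -x + z = (-x + y) + (-y + z) := by abel
      exact (congrArg p h).le.trans (p.add_le (-x + y) (-y + z))
    dist_eq := fun _ _ => rfl
    norm_mul_le := fun x y => p.mul_le x y }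

instance : NormedAlgebra ℂ p.Pre where
  norm_smul_le c x := (p.smul_eq c x).le

instance : NormedStarGroup p.Pre where
  norm_star_le x := (p.star_eq x).le

/-- The C*-algebra defined by a C*-seminorm `p` on `F`: the Hausdorff completion of `F` with respect
to `p`, that is, the completion of the quotient of `F` by the null space of `p`. -/
def Completion : Type _ := UniformSpace.Completion p.Pre

section Completion

open UniformSpace

instance : NormedRing p.Completion := inferInstanceAs (NormedRing (UniformSpace.Completion p.Pre))

instance : CompleteSpace p.Completion :=
  inferInstanceAs (CompleteSpace (UniformSpace.Completion p.Pre))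

instance : Algebra ℂ p.Completion := inferInstanceAs (Algebra ℂ (UniformSpace.Completion p.Pre))

/-- The canonical map from `F` to its completion. -/
def toCompletion (x : F) : p.Completion := UniformSpace.Completion.coe' (α := p.Pre) x

theorem norm_toCompletion (x : F) : ‖p.toCompletion x‖ = p x :=
  UniformSpace.Completion.norm_coe (E := p.Pre) x

theorem toCompletion_add (x y : F) :
    p.toCompletion (x + y) = p.toCompletion x + p.toCompletion y :=
  UniformSpace.Completion.coe_add (α := p.Pre) x y

theorem toCompletion_mul (x y : F) :
    p.toCompletion (x * y) = p.toCompletion x * p.toCompletion y :=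
  UniformSpace.Completion.coe_mul (α := p.Pre) x y

theorem toCompletion_smul (c : ℂ) (x : F) :
    p.toCompletion (c • x) = c • p.toCompletion x :=
  UniformSpace.Completion.coe_smul (X := p.Pre) c x

theorem completion_induction {P : p.Completion → Prop} (hP : IsClosed {x | P x})
    (h : ∀ x : F, P (p.toCompletion x)) (x : p.Completion) : P x :=
  UniformSpace.Completion.induction_on (α := p.Pre) x hP h

theorem completion_induction₂ {P : p.Completion → p.Completion → Prop}
    (hP : IsClosed {x : p.Completion × p.Completion | P x.1 x.2})
    (h : ∀ x y : F, P (p.toCompletion x) (p.toCompletion y)) (x y : p.Completion) : P x y :=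
  UniformSpace.Completion.induction_on₂ (α := p.Pre) (β := p.Pre) x y hP h

instance : Star p.Completion :=
  ⟨UniformSpace.Completion.map (α := p.Pre) (β := p.Pre) star⟩

theorem star_toCompletion (x : F) : star (p.toCompletion x) = p.toCompletion (star x) :=
  UniformSpace.Completion.map_coe (α := p.Pre) (β := p.Pre)
    (star_isometry (E := p.Pre)).uniformContinuous x

theorem continuous_star_completion : Continuous (star : p.Completion → p.Completion) :=
  UniformSpace.Completion.continuous_map (α := p.Pre) (β := p.Pre)

instance : StarRing p.Completion where
  star_involutive := p.completion_induction
    (isClosed_eq (p.continuous_star_completion.comp p.continuous_star_completion) continuous_id)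
    fun x => by rw [star_toCompletion, star_toCompletion, star_star]
  star_mul := p.completion_induction₂
    (isClosed_eq (p.continuous_star_completion.comp (continuous_fst.mul continuous_snd))
      ((p.continuous_star_completion.comp continuous_snd).mul
        (p.continuous_star_completion.comp continuous_fst)))
    fun x y => by
      rw [← toCompletion_mul, star_toCompletion, star_toCompletion, star_toCompletion, star_mul,
        toCompletion_mul]
  star_add := p.completion_induction₂
    (isClosed_eq (p.continuous_star_completion.comp (continuous_fst.add continuous_snd))
      ((p.continuous_star_completion.comp continuous_fst).add
        (p.continuous_star_completion.comp continuous_snd)))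
    fun x y => by
      rw [← toCompletion_add, star_toCompletion, star_toCompletion, star_toCompletion, star_add,
        toCompletion_add]

instance : NormedAlgebra ℂ p.Completion where
  norm_smul_le c := p.completion_induction
    (isClosed_le (continuous_norm.comp (continuous_const_smul c))
      (continuous_const.mul continuous_norm))
    fun x => by rw [← toCompletion_smul, norm_toCompletion, norm_toCompletion, p.smul_eq]

instance : CStarRing p.Completion where
  norm_mul_self_le := p.completion_induction
    (isClosed_le (continuous_norm.mul continuous_norm)
      (continuous_norm.comp (p.continuous_star_completion.mul continuous_id)))
    fun x => by
      rw [star_toCompletion, ← toCompletion_mul, norm_toCompletion, norm_toCompletion,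
        p.star_mul_self]

instance [StarModule ℂ F] : StarModule ℂ p.Completion where
  star_smul c := p.completion_induction
    (isClosed_eq (p.continuous_star_completion.comp (continuous_const_smul c))
      ((continuous_const_smul (star c)).comp p.continuous_star_completion))
    fun x => by
      rw [← toCompletion_smul, star_toCompletion, star_toCompletion, star_smul, toCompletion_smul]

instance [StarModule ℂ F] : CStarAlgebra p.Completion where

end Completion

end Pre

/-- The C*-seminorm `p` satisfies the relations `x = y` for all pairs with `rel x y`. -/
def Satisfies (p : CStarSeminorm F) (rel : F → F → Prop) : Prop :=
  ∀ x y, rel x y → p (x - y) = 0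

instance : Zero (CStarSeminorm F) :=
  ⟨{ (0 : Seminorm ℂ F) with
      mul_le' := fun _ _ => (mul_zero (0 : ℝ)).ge
      star_mul_self' := fun _ => (mul_zero (0 : ℝ)).symm }⟩

theorem zero_satisfies (rel : F → F → Prop) : (0 : CStarSeminorm F).Satisfies rel :=
  fun _ _ _ => rfl

/-- The values at `x` of all C*-seminorms that satisfy the relations `rel`. -/
def values (rel : F → F → Prop) (x : F) : Set ℝ :=
  Set.range fun p : {p : CStarSeminorm F // p.Satisfies rel} => p.1 x

theorem _root_.BddAbove.values_add {rel : F → F → Prop} {x y : F} (hx : BddAbove (values rel x))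
    (hy : BddAbove (values rel y)) : BddAbove (values rel (x + y)) := by
  obtain ⟨a, ha⟩ := hx
  obtain ⟨b, hb⟩ := hy
  refine ⟨a + b, ?_⟩
  rintro _ ⟨p, rfl⟩
  exact (p.1.add_le x y).trans (add_le_add (ha ⟨p, rfl⟩) (hb ⟨p, rfl⟩))

theorem _root_.BddAbove.values_mul {rel : F → F → Prop} {x y : F} (hx : BddAbove (values rel x))
    (hy : BddAbove (values rel y)) : BddAbove (values rel (x * y)) := by
  obtain ⟨a, ha⟩ := hx
  obtain ⟨b, hb⟩ := hy
  refine ⟨a * b, ?_⟩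
  rintro _ ⟨p, rfl⟩
  exact (p.1.mul_le x y).trans (mul_le_mul (ha ⟨p, rfl⟩) (hb ⟨p, rfl⟩) (p.1.nonneg y)
    ((p.1.nonneg x).trans (ha ⟨p, rfl⟩)))

theorem _root_.BddAbove.values_smul {rel : F → F → Prop} {x : F} (c : ℂ)
    (hx : BddAbove (values rel x)) : BddAbove (values rel (c • x)) := by
  obtain ⟨a, ha⟩ := hx
  refine ⟨‖c‖ * a, ?_⟩
  rintro _ ⟨p, rfl⟩
  exact (p.1.smul_eq c x).le.trans (mul_le_mul_of_nonneg_left (ha ⟨p, rfl⟩) (norm_nonneg c))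

theorem _root_.BddAbove.values_star {rel : F → F → Prop} {x : F}
    (hx : BddAbove (values rel x)) : BddAbove (values rel (star x)) := by
  obtain ⟨a, ha⟩ := hx
  refine ⟨a, ?_⟩
  rintro _ ⟨p, rfl⟩
  exact (p.1.star_eq x).le.trans (ha ⟨p, rfl⟩)

theorem bddAbove_values_one (rel : F → F → Prop) : BddAbove (values rel (1 : F)) :=
  ⟨1, by rintro _ ⟨p, rfl⟩; exact p.1.one_le_one⟩

theorem bddAbove_values_of_star_mul_self {rel : F → F → Prop} {x : F}
    (h : ∀ p : CStarSeminorm F, p.Satisfies rel → p (star x * x - 1) = 0) :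
    BddAbove (values rel x) := by
  refine ⟨1, ?_⟩
  rintro _ ⟨p, rfl⟩
  have h1 := p.1.congr (h p.1 p.2)
  rw [p.1.star_mul_self] at h1
  have h2 := p.1.one_le_one
  change p.1 x ≤ 1
  nlinarith [p.1.nonneg x]

open scoped Pointwise in
/-- The supremum of all C*-seminorms that satisfy the relations `rel`, provided that it is finite
at every point. It is the largest C*-seminorm satisfying `rel`. -/
def universal (rel : F → F → Prop) (h : ∀ x, BddAbove (values rel x)) : CStarSeminorm F where
  toFun x := sSup (values rel x)
  map_zero' := le_antisymm
    (csSup_le ⟨_, ⟨0, zero_satisfies rel⟩, rfl⟩ (by rintro _ ⟨p, rfl⟩; simp))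
    (Real.sSup_nonneg (by rintro _ ⟨p, rfl⟩; exact p.1.nonneg _))
  add_le' x y := by
    refine csSup_le ⟨_, ⟨0, zero_satisfies rel⟩, rfl⟩ ?_
    rintro _ ⟨p, rfl⟩
    exact (p.1.add_le x y).trans (add_le_add (le_csSup (h x) ⟨p, rfl⟩) (le_csSup (h y) ⟨p, rfl⟩))
  neg' x := by simp [values]
  smul' c x := by
    have : values rel (c • x) = ‖c‖ • values rel x := by
      ext t
      simp only [values, smul_eq, Set.mem_range, Set.mem_smul_set]
      constructor
      · rintro ⟨p, rfl⟩; exact ⟨_, ⟨p, rfl⟩, rfl⟩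
      · rintro ⟨_, ⟨p, rfl⟩, rfl⟩; exact ⟨p, rfl⟩
    rw [this, Real.sSup_smul_of_nonneg (norm_nonneg c), smul_eq_mul]
  mul_le' x y := by
    refine csSup_le ⟨_, ⟨0, zero_satisfies rel⟩, rfl⟩ ?_
    rintro _ ⟨p, rfl⟩
    exact (p.1.mul_le x y).trans (mul_le_mul (le_csSup (h x) ⟨p, rfl⟩) (le_csSup (h y) ⟨p, rfl⟩)
      (p.1.nonneg y) ((p.1.nonneg x).trans (le_csSup (h x) ⟨p, rfl⟩)))
  star_mul_self' x := by
    have h0 : 0 ≤ sSup (values rel x) :=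
      Real.sSup_nonneg (by rintro _ ⟨p, rfl⟩; exact p.1.nonneg _)
    apply le_antisymm
    · refine csSup_le ⟨_, ⟨0, zero_satisfies rel⟩, rfl⟩ ?_
      rintro _ ⟨p, rfl⟩
      have h1 : p.1 x ≤ sSup (values rel x) := le_csSup (h x) ⟨p, rfl⟩
      exact (p.1.star_mul_self x).le.trans (mul_le_mul h1 h1 (p.1.nonneg x) h0)
    · have h1 : sSup (values rel x) ≤ √(sSup (values rel (star x * x))) := by
        refine csSup_le ⟨_, ⟨0, zero_satisfies rel⟩, rfl⟩ ?_
        rintro _ ⟨p, rfl⟩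
        refine Real.le_sqrt_of_sq_le ?_
        rw [sq, ← p.1.star_mul_self]
        exact le_csSup (h _) ⟨p, rfl⟩
      refine (mul_le_mul h1 h1 h0 (Real.sqrt_nonneg _)).trans (Real.mul_self_sqrt ?_).le
      exact Real.sSup_nonneg (by rintro _ ⟨p, rfl⟩; exact p.1.nonneg _)

end CStarSeminorm

/-- The universal C*-algebra of the *-algebra `F` subject to the relations `rel`: the Hausdorff
completion of `F` with respect to the supremum of all C*-seminorms satisfying `rel`. -/
abbrev UniversalCStarAlgebra {F : Type*} [Ring F] [StarRing F] [Algebra ℂ F]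
    (rel : F → F → Prop) (h : ∀ x, BddAbove (CStarSeminorm.values rel x)) : Type _ :=
  (CStarSeminorm.universal rel h).Completion

/-! ### The maximal tensor product of C*-algebras -/

section MaxTensor

variable (A B : Type*) [CStarAlgebra A] [CStarAlgebra B]

theorem bddAbove_values_tensor (x : A ⊗[ℂ] B) :
    BddAbove (CStarSeminorm.values (fun _ _ : A ⊗[ℂ] B => False) x) := by
  induction x with
  | zero =>
    simpa using (CStarSeminorm.bddAbove_values_one (fun _ _ : A ⊗[ℂ] B => False)).values_smul 0
  | add x y hx hy => exact hx.values_add hy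
  | tmul a b =>
    have ha : a ∈ Submodule.span ℂ (unitary A : Set A) := by simp [CStarAlgebra.span_unitary A]
    have hb : b ∈ Submodule.span ℂ (unitary B : Set B) := by simp [CStarAlgebra.span_unitary B]
    have h0 : BddAbove (CStarSeminorm.values (fun _ _ : A ⊗[ℂ] B => False) 0) := by
      simpa using (CStarSeminorm.bddAbove_values_one (fun _ _ : A ⊗[ℂ] B => False)).values_smul 0
    induction ha using Submodule.span_induction with
    | zero => rwa [TensorProduct.zero_tmul]
    | add a a' _ _ h h' => rw [TensorProduct.add_tmul]; exact h.values_add h'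
    | smul c a _ h => rw [← TensorProduct.smul_tmul']; exact h.values_smul c
    | mem u hu =>
      induction hb using Submodule.span_induction with
      | zero => rwa [TensorProduct.tmul_zero]
      | add b b' _ _ h h' => rw [TensorProduct.tmul_add]; exact h.values_add h'
      | smul c b _ h => rw [TensorProduct.tmul_smul]; exact h.values_smul c
      | mem v hv =>
        refine CStarSeminorm.bddAbove_values_of_star_mul_self fun p _ => ?_
        have h1 : star (u ⊗ₜ[ℂ] v) * (u ⊗ₜ[ℂ] v) = 1 := by
          rw [TensorProduct.star_tmul, Algebra.TensorProduct.tmul_mul_tmul,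
            Unitary.star_mul_self_of_mem hu, Unitary.star_mul_self_of_mem hv]
          rfl
        rw [h1, sub_self]
        exact map_zero p.toSeminorm

/-- The maximal tensor product of two C*-algebras: the completion of the algebraic tensor product
with respect to the largest C*-seminorm. -/
abbrev MaxTensorProduct : Type _ :=
  UniversalCStarAlgebra (fun _ _ : A ⊗[ℂ] B => False) (bddAbove_values_tensor A B)

end MaxTensor

/-! ### The spatial (minimal) tensor product of concrete C*-algebras -/

section MinTensor

variable (H K : Type*) [NormedAddCommGroup H] [InnerProductSpace ℂ H]
  [NormedAddCommGroup K] [InnerProductSpace ℂ K]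

/-- The Hilbert space tensor product. -/
def HilbertTensor : Type _ := UniformSpace.Completion (H ⊗[ℂ] K)

instance : NormedAddCommGroup (HilbertTensor H K) :=
  inferInstanceAs (NormedAddCommGroup (UniformSpace.Completion (H ⊗[ℂ] K)))

instance : InnerProductSpace ℂ (HilbertTensor H K) :=
  inferInstanceAs (InnerProductSpace ℂ (UniformSpace.Completion (H ⊗[ℂ] K)))

instance : CompleteSpace (HilbertTensor H K) :=
  inferInstanceAs (CompleteSpace (UniformSpace.Completion (H ⊗[ℂ] K)))

variable {H K}

/-- The elementary tensor `x ⊗ y` of two vectors in the Hilbert space tensor product. -/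
def hilbertTmul (x : H) (y : K) : HilbertTensor H K :=
  UniformSpace.Completion.coe' (x ⊗ₜ[ℂ] y)

/-- The operator `S ⊗ T` on the Hilbert space tensor product, with
`(S ⊗ T) (x ⊗ y) = S x ⊗ T y`. -/
def tensorOperator (S : H →L[ℂ] H) (T : K →L[ℂ] K) :
    HilbertTensor H K →L[ℂ] HilbertTensor H K :=
  (TensorProduct.mapL S T).completion

theorem tensorOperator_tmul (S : H →L[ℂ] H) (T : K →L[ℂ] K) (x : H) (y : K) :
    tensorOperator S T (hilbertTmul x y) = hilbertTmul (S x) (T y) :=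
  UniformSpace.Completion.map_coe (TensorProduct.mapL S T).uniformContinuous (x ⊗ₜ[ℂ] y)

theorem inner_hilbertTmul (x x' : H) (y y' : K) :
    inner ℂ (hilbertTmul x y) (hilbertTmul x' y') = inner ℂ x x' * inner ℂ y y' :=
  (UniformSpace.Completion.inner_coe (x ⊗ₜ[ℂ] y) (x' ⊗ₜ[ℂ] y')).trans
    (TensorProduct.inner_tmul (𝕜 := ℂ) x x' y y')

/-- The minimal tensor product of C*-algebras `A ⊆ B(H)` and `B ⊆ B(K)`: the norm closure in
`B(H ⊗ K)` of the algebraic tensor product of `A` and `B`. (The *-algebra generated by the operators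
`S ⊗ T` with `S` in `A` and `T` in `B` is their linear span, the algebraic tensor product.) -/
def minTensorProduct [CompleteSpace H] [CompleteSpace K]
    (A : StarSubalgebra ℂ (H →L[ℂ] H)) (B : StarSubalgebra ℂ (K →L[ℂ] K)) :
    StarSubalgebra ℂ (HilbertTensor H K →L[ℂ] HilbertTensor H K) :=
  (StarAlgebra.adjoin ℂ {X | ∃ S ∈ A, ∃ T ∈ B, X = tensorOperator S T}).topologicalClosure

end MinTensor

/-! ### Invariant algebras of sets over a ring -/

/-- An algebra of subsets of the ring `R` that is invariant under the injective affine
transformations `x ↦ a + b * x`, where `a : R` and `b` is a regular element of `R`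
(neither a left nor a right zero-divisor). -/
structure InvariantSetAlgebra (R : Type*) [Ring R] where
  sets : Set (Set R)
  isSetAlgebra : MeasureTheory.IsSetAlgebra sets
  affine_mem : ∀ X ∈ sets, ∀ (a : R), ∀ b ∈ R⁰, (fun x => a + b * x) '' X ∈ sets

namespace InvariantSetAlgebra

variable {R : Type*} [Ring R]

/-- The smallest invariant algebra over `R` containing the family `G` of subsets of `R`. -/
def generate (G : Set (Set R)) : InvariantSetAlgebra R where
  sets := {X | ∀ C : InvariantSetAlgebra R, G ⊆ C.sets → X ∈ C.sets}
  isSetAlgebra :=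
    { empty_mem := fun C _ => C.isSetAlgebra.empty_mem
      compl_mem := fun _ hs C hC => C.isSetAlgebra.compl_mem (hs C hC)
      union_mem := fun _ _ hs ht C hC => C.isSetAlgebra.union_mem (hs C hC) (ht C hC) }
  affine_mem := fun X hX a b hb C hC => C.affine_mem X (hX C hC) a b hb

/-- The smallest invariant algebra over `R₁ × R₂` containing all products `X₁ × X₂` of members
`X₁` of `C₁` and `X₂` of `C₂`. -/
def prod {R₁ R₂ : Type*} [Ring R₁] [Ring R₂] (C₁ : InvariantSetAlgebra R₁)
    (C₂ : InvariantSetAlgebra R₂) : InvariantSetAlgebra (R₁ × R₂) :=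
  generate {X | ∃ X₁ ∈ C₁.sets, ∃ X₂ ∈ C₂.sets, X = X₁ ×ˢ X₂}

end InvariantSetAlgebra

/-! ### The reduced ring C*-algebra -/

section Reduced

/-- The Hilbert space `ℓ²(R)`. -/
abbrev EllTwo (R : Type*) : Type _ := lp (fun _ : R => ℂ) 2

open Classical in
/-- The canonical orthonormal basis vectors of `ℓ²(R)`. -/
def ellTwoBasis {R : Type*} (r : R) : EllTwo R := lp.single 2 r (1 : ℂ)

theorem orthonormal_ellTwoBasis {R : Type*} : Orthonormal ℂ (ellTwoBasis : R → EllTwo R) := by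
  classical
  rw [orthonormal_iff_ite]
  intro i j
  simp [ellTwoBasis, lp.inner_single_left, lp.single_apply, Pi.single_apply]

/-- The isometry of `ℓ²(R)` that sends the basis vector at `r` to the basis vector at `f r`, for an
injective map `f`. -/
def injectionOperator {R : Type*} (f : R → R) (hf : Function.Injective f) :
    EllTwo R →L[ℂ] EllTwo R :=
  ((orthonormal_ellTwoBasis.comp f hf).orthogonalFamily.linearIsometry).toContinuousLinearMap

theorem injectionOperator_basis {R : Type*} (f : R → R) (hf : Function.Injective f) (r : R) :
    injectionOperator f hf (ellTwoBasis r) = ellTwoBasis (f r) := by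
  classical
  have h := (orthonormal_ellTwoBasis.comp f hf).orthogonalFamily.linearIsometry_apply_single
    (i := r) (1 : ℂ)
  simpa only [injectionOperator, ellTwoBasis, LinearIsometry.coe_toContinuousLinearMap,
    LinearIsometry.toSpanSingleton_apply, one_smul, Function.comp_apply] using h

/-- The operator `E_X` on `ℓ²(R)`: multiplication by the characteristic function of `X`. -/
def indicatorOperator {R : Type*} (X : Set R) : EllTwo R →L[ℂ] EllTwo R :=
  LinearMap.mkContinuous
    { toFun := fun f => ⟨X.indicator f, (lp.memℓp f).mono' fun i => norm_indicator_le_norm_self f i⟩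
      map_add' := fun f g => by
        ext i
        exact congrFun (Set.indicator_add X f g) i
      map_smul' := fun c f => by
        ext i
        exact congrFun (Set.indicator_const_smul X c f) i }
    1 fun f => by
      rw [one_mul]
      exact lp.norm_mono (by norm_num) fun i => norm_indicator_le_norm_self f i

theorem indicatorOperator_apply {R : Type*} (X : Set R) (f : EllTwo R) (r : R) :
    indicatorOperator X f r = X.indicator f r := rfl

variable {R : Type*} [Ring R]

/-- The unitary `U^a` on `ℓ²(R)`, with `U^a ξ_r = ξ_(a+r)`. -/
def translationOperator (a : R) : EllTwo R →L[ℂ] EllTwo R :=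
  injectionOperator (fun r => a + r) (add_right_injective a)

/-- The isometry `S_b` on `ℓ²(R)`, for a regular element `b`, with `S_b ξ_r = ξ_(b*r)`. -/
def multiplicationOperator (b : R⁰) : EllTwo R →L[ℂ] EllTwo R :=
  injectionOperator (fun r => b * r) fun x y h => by
    have h1 : (b : R) * (x - y) = 0 := by rw [mul_sub]; exact sub_eq_zero.2 h
    exact sub_eq_zero.1 (b.2.1 _ h1)

/-- The reduced ring C*-algebra of `R` with respect to `C`: the C*-algebra of operators on `ℓ²(R)`
generated by all `E_X`, `U^a` and `S_b`. -/
def reducedRingCStarAlgebra (C : InvariantSetAlgebra R) :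
    StarSubalgebra ℂ (EllTwo R →L[ℂ] EllTwo R) :=
  (StarAlgebra.adjoin ℂ
    (indicatorOperator '' C.sets ∪ Set.range translationOperator ∪
      Set.range multiplicationOperator)).topologicalClosure

end Reduced

/-! ### Free unital *-algebras -/

/-- Words in the letters `g` and `g*`, for `g` in `G`; the letter `g` is `(g, false)` and the letter
`g*` is `(g, true)`. -/
def StarWord (G : Type*) : Type _ := FreeMonoid (G × Bool)

namespace StarWord

variable {G : Type*}

instance : Monoid (StarWord G) := inferInstanceAs (Monoid (FreeMonoid (G × Bool)))

instance : StarMul (StarWord G) where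
  star w := FreeMonoid.ofList (((FreeMonoid.toList w).map fun l => (l.1, !l.2)).reverse)
  star_involutive w := by
    change FreeMonoid.ofList _ = w
    simp [Function.comp_def]
    rfl
  star_mul v w := congrArg FreeMonoid.ofList (by
    change ((FreeMonoid.toList v ++ FreeMonoid.toList w).map _).reverse = _
    rw [List.map_append, List.reverse_append]
    rfl)

/-- The one-letter word `g`. -/
def letter (g : G) : StarWord G := FreeMonoid.of (g, false)

theorem star_letter (g : G) : star (letter g) = FreeMonoid.of (g, true) := rfl

end StarWord

/-- The free unital complex *-algebra on the set `G`: formal complex linear combinations of words in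
the letters `g` and `g*`, multiplied by concatenation. -/
def FreeStarAlgebra (G : Type*) : Type _ := MonoidAlgebra ℂ (StarWord G)

namespace FreeStarAlgebra

variable {G : Type*}

instance : Ring (FreeStarAlgebra G) := inferInstanceAs (Ring (MonoidAlgebra ℂ (StarWord G)))

instance : Algebra ℂ (FreeStarAlgebra G) :=
  inferInstanceAs (Algebra ℂ (MonoidAlgebra ℂ (StarWord G)))

/-- The monomial with coefficient `c` and word `w`. -/
def monomial (w : StarWord G) (c : ℂ) : FreeStarAlgebra G := MonoidAlgebra.single w c

theorem monomial_add (w : StarWord G) (c d : ℂ) :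
    monomial w (c + d) = monomial w c + monomial w d := MonoidAlgebra.single_add w c d

theorem monomial_zero (w : StarWord G) : monomial w 0 = 0 := MonoidAlgebra.single_zero w

theorem monomial_mul (v w : StarWord G) (c d : ℂ) :
    monomial v c * monomial w d = monomial (v * w) (c * d) :=
  MonoidAlgebra.single_mul_single v w c d

theorem smul_monomial (w : StarWord G) (c d : ℂ) : c • monomial w d = monomial w (c * d) :=
  MonoidAlgebra.smul_single c w d

theorem induction {P : FreeStarAlgebra G → Prop} (x : FreeStarAlgebra G) (zero : P 0)
    (add : ∀ x y, P x → P y → P (x + y)) (mon : ∀ w c, P (monomial w c)) : P x :=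
  MonoidAlgebra.induction_linear (motive := P) x zero (fun x y => add x y) mon

/-- The additive map with `(c w)* = conj c w*` on monomials. -/
def starHom : FreeStarAlgebra G →+ FreeStarAlgebra G where
  toFun x := (MonoidAlgebra.coeff x).sum fun w c => monomial (star w) (star c)
  map_zero' := Finsupp.sum_zero_index
  map_add' x y := Finsupp.sum_add_index'
    (fun w => by rw [star_zero, monomial_zero])
    (fun w c d => by rw [star_add, monomial_add])

theorem starHom_monomial (w : StarWord G) (c : ℂ) :
    starHom (monomial w c) = monomial (star w) (star c) :=
  Finsupp.sum_single_index (h := fun w c => monomial (G := G) (star w) (star c))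
    (by rw [star_zero, monomial_zero])

instance : StarRing (FreeStarAlgebra G) where
  star := starHom
  star_involutive x := by
    induction x using induction with
    | zero => rw [map_zero, map_zero]
    | add x y hx hy => rw [map_add, map_add, hx, hy]
    | mon w c => rw [starHom_monomial, starHom_monomial, star_star, star_star]
  star_mul x y := by
    change starHom (x * y) = starHom y * starHom x
    induction x using induction with
    | zero => rw [zero_mul, map_zero, mul_zero]
    | add x x' hx hx' => rw [add_mul, map_add, map_add, mul_add, hx, hx']
    | mon v c =>
      induction y using induction with
      | zero => rw [mul_zero, map_zero, zero_mul]
      | add y y' hy hy' => rw [mul_add, map_add, map_add, add_mul, hy, hy']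
      | mon w d =>
        rw [monomial_mul, starHom_monomial, starHom_monomial, starHom_monomial, monomial_mul,
          star_mul, star_mul]
  star_add := map_add starHom

theorem star_monomial (w : StarWord G) (c : ℂ) :
    star (monomial w c) = monomial (star w) (star c) := starHom_monomial w c

instance : StarModule ℂ (FreeStarAlgebra G) where
  star_smul c x := by
    induction x using induction with
    | zero => rw [smul_zero, star_zero, smul_zero]
    | add x y hx hy => rw [smul_add, star_add, star_add, smul_add, hx, hy]
    | mon w d => rw [smul_monomial, star_monomial, star_monomial, smul_monomial, star_mul']

/-- The generator `g` of the free *-algebra. -/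
def of (g : G) : FreeStarAlgebra G := monomial (StarWord.letter g) 1

/-- If every generator is bounded under the C*-seminorms that satisfy given relations, then so is
every element. -/
theorem bddAbove_values {rel : FreeStarAlgebra G → FreeStarAlgebra G → Prop}
    (h : ∀ g, BddAbove (CStarSeminorm.values rel (of g))) (x : FreeStarAlgebra G) :
    BddAbove (CStarSeminorm.values rel x) := by
  have h1 := CStarSeminorm.bddAbove_values_one rel
  induction x using induction with
  | zero => simpa using h1.values_smul 0
  | add x y hx hy => exact hx.values_add hy
  | mon w c =>
    have hw : BddAbove (CStarSeminorm.values rel (monomial w 1)) := by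
      induction w using FreeMonoid.inductionOn' with
      | one => exact h1
      | of_mul l w ih =>
        have h2 : BddAbove (CStarSeminorm.values rel (monomial (FreeMonoid.of l) 1)) := by
          obtain ⟨g, b⟩ := l
          cases b with
          | false => exact h g
          | true =>
            have h3 := (h g).values_star
            rwa [of, star_monomial, star_one] at h3
        have h4 := monomial_mul (G := G) (FreeMonoid.of l) w 1 1
        rw [one_mul] at h4
        have h5 := h2.values_mul ih
        rw [h4] at h5
        exact h5
    have h5 := hw.values_smul c
    rwa [smul_monomial, mul_one] at h5

end FreeStarAlgebra

/-! ### The full ring C*-algebra -/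

section Full

variable {R : Type*} [Ring R]

/-- The generators of the full ring C*-algebra. -/
inductive RingGenerator (C : InvariantSetAlgebra R) : Type _
  | e (X : Set R) (hX : X ∈ C.sets) : RingGenerator C
  | u (a : R) : RingGenerator C
  | s (b : R⁰) : RingGenerator C

namespace RingGenerator

variable (C : InvariantSetAlgebra R)

/-- The generator `e_X` in the free *-algebra. -/
def E (X : Set R) (hX : X ∈ C.sets) : FreeStarAlgebra (RingGenerator C) :=
  FreeStarAlgebra.of (e X hX)

/-- The generator `u^a` in the free *-algebra. -/
def U (a : R) : FreeStarAlgebra (RingGenerator C) := FreeStarAlgebra.of (u a)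

/-- The generator `s_b` in the free *-algebra. -/
def S (b : R⁰) : FreeStarAlgebra (RingGenerator C) := FreeStarAlgebra.of (s b)

/-- The defining relations of the full ring C*-algebra. -/
inductive Rel : FreeStarAlgebra (RingGenerator C) → FreeStarAlgebra (RingGenerator C) → Prop
  /- The `e_X` are projections, the `u^a` are unitaries and the `s_b` are isometries. -/
  | e_star (X hX) : Rel (star (E C X hX)) (E C X hX)
  | e_idem (X hX) : Rel (E C X hX * E C X hX) (E C X hX)
  | u_star_mul (a) : Rel (star (U C a) * U C a) 1
  | u_mul_star (a) : Rel (U C a * star (U C a)) 1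
  | s_star_mul (b) : Rel (star (S C b) * S C b) 1
  /- `(a, b) ↦ u^a s_b` is a homomorphism on the `ax+b`-semigroup, normalised by `u^0 = 1`. -/
  | u_zero : Rel (U C 0) 1
  | affine_mul (a c : R) (b d : R⁰) :
      Rel (U C a * S C b * (U C c * S C d)) (U C (a + b * c) * S C (b * d))
  /- It implements the action on sets by affine transformations. -/
  | affine_e (a : R) (b : R⁰) (X hX) :
      Rel (U C a * S C b * E C X hX * star (U C a * S C b))
        (E C ((fun x => a + b * x) '' X) (C.affine_mem X hX a b b.2))
  /- `X ↦ e_X` is a finitely additive spectral measure. -/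
  | e_univ : Rel (E C Set.univ C.isSetAlgebra.univ_mem) 1
  | e_inter (X Y hX hY) :
      Rel (E C X hX * E C Y hY) (E C (X ∩ Y) (C.isSetAlgebra.inter_mem hX hY))
  | e_disjoint_union (X Y hX hY) (hXY : Disjoint X Y) :
      Rel (E C (X ∪ Y) (C.isSetAlgebra.union_mem hX hY)) (E C X hX + E C Y hY)

theorem bddAbove_values (x : FreeStarAlgebra (RingGenerator C)) :
    BddAbove (CStarSeminorm.values (Rel C) x) := by
  refine FreeStarAlgebra.bddAbove_values (fun g => ?_) x
  cases g with
  | e X hX =>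
    refine ⟨1, ?_⟩
    rintro _ ⟨p, rfl⟩
    change p.1 (E C X hX) ≤ 1
    have h1 := p.1.star_mul_self (E C X hX)
    have h2 := p.1.congr (p.2 _ _ (Rel.e_idem X hX))
    have h3 : p.1 (star (E C X hX) * E C X hX) ≤ p.1 (E C X hX) := by
      have h4 : star (E C X hX) * E C X hX =
        (star (E C X hX) - E C X hX) * E C X hX + E C X hX * E C X hX := by noncomm_ring
      rw [h4]
      refine (p.1.add_le _ _).trans ?_
      have h5 := p.1.mul_le (star (E C X hX) - E C X hX) (E C X hX)
      rw [p.2 _ _ (Rel.e_star X hX), zero_mul] at h5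
      linarith
    nlinarith [p.1.nonneg (E C X hX)]
  | u a =>
    exact CStarSeminorm.bddAbove_values_of_star_mul_self fun p hp => hp _ _ (Rel.u_star_mul a)
  | s b =>
    exact CStarSeminorm.bddAbove_values_of_star_mul_self fun p hp => hp _ _ (Rel.s_star_mul b)

end RingGenerator

/-- The full ring C*-algebra of `R` with respect to `C`: the universal C*-algebra generated by
projections `e_X`, unitaries `u^a` and isometries `s_b` satisfying `RingGenerator.Rel`. -/
abbrev FullRingCStarAlgebra (C : InvariantSetAlgebra R) : Type _ :=
  UniversalCStarAlgebra (RingGenerator.Rel C) (RingGenerator.bddAbove_values C)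

end Full

end

noncomputable section

/-! ### Product set algebras -/

section RegularPairs

variable {R₁ R₂ : Type*} [Ring R₁] [Ring R₂]

/-! Over a product ring everything splits. An element is regular iff both components are, so the
affine injections of R₁ × R₂ are the pairs of affine injections of the factors, and they carry
rectangles to rectangles. Hence the set algebra generated by the rectangles is already invariant
(`prod_sets`), and a property that passes to complements and intersections need only be checked on
rectangles (`prod_induction`).

Reduced algebras: the unitary ℓ²(R₁ × R₂) ≅ ℓ²(R₁) ⊗ ℓ²(R₂) carries E_(X×Y) to E_X ⊗ E_Y, and U and
S likewise to elementary tensors. Since E_R, U^0 and S_1 are identities, the operators S ⊗ 1 and 1 ⊗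
T, for generators S and T, also come from generators. So conjugation by the unitary matches the two
closed algebras.

Full algebras: universal properties give homomorphisms both ways, inverse to each other on
generators. From the tensor product, the restrictions of the canonical representation to the two
factors must have commuting ranges (`commute_lift_restrict`). The delicate point is the adjoints of
the isometries: an isometry v that commutes with w need not have v* commuting with w, but here v v*
is one of the projections e_X, and that is enough.

Towards the tensor product, two commuting representations must combine into one of the product ring
(`RingRepresentation.prod`), and e_X has to be defined when X is not a rectangle
(`IsSpectral.exists_prod`). The value P at X is characterised by rectangles: those inside X absorb
P, those outside X annihilate it. It is unique because X is built from rectangles by Boolean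
operations; admissible values are stable under 1 - P and P * Q, which gives existence by induction
and then the identities of a spectral measure by uniqueness. -/

theorem mem_nonZeroDivisors_prod_iff {b : R₁ × R₂} :
    b ∈ (R₁ × R₂)⁰ ↔ b.1 ∈ R₁⁰ ∧ b.2 ∈ R₂⁰ := by
  simp only [mem_nonZeroDivisors_iff]
  constructor
  · rintro ⟨h, h'⟩
    refine ⟨⟨fun x hx => ?_, fun x hx => ?_⟩, ⟨fun x hx => ?_, fun x hx => ?_⟩⟩
    · exact congrArg Prod.fst (h (x, 0) (Prod.ext hx (mul_zero _)))
    · exact congrArg Prod.fst (h' (x, 0) (Prod.ext hx (zero_mul _)))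
    · exact congrArg Prod.snd (h (0, x) (Prod.ext (mul_zero _) hx))
    · exact congrArg Prod.snd (h' (0, x) (Prod.ext (zero_mul _) hx))
  · rintro ⟨⟨h₁, h₁'⟩, ⟨h₂, h₂'⟩⟩
    refine ⟨fun x hx => ?_, fun x hx => ?_⟩
    · exact Prod.ext (h₁ _ (congrArg Prod.fst hx)) (h₂ _ (congrArg Prod.snd hx))
    · exact Prod.ext (h₁' _ (congrArg Prod.fst hx)) (h₂' _ (congrArg Prod.snd hx))

/-- The pair of two regular elements, as a regular element of the product ring. -/
def regularPair (b₁ : R₁⁰) (b₂ : R₂⁰) : (R₁ × R₂)⁰ :=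
  ⟨(b₁, b₂), mem_nonZeroDivisors_prod_iff.2 ⟨b₁.2, b₂.2⟩⟩

/-- The first component of a regular element of a product ring. -/
def regularFst (b : (R₁ × R₂)⁰) : R₁⁰ := ⟨b.1.1, (mem_nonZeroDivisors_prod_iff.1 b.2).1⟩

/-- The second component of a regular element of a product ring. -/
def regularSnd (b : (R₁ × R₂)⁰) : R₂⁰ := ⟨b.1.2, (mem_nonZeroDivisors_prod_iff.1 b.2).2⟩

theorem regularPair_mul (b₁ d₁ : R₁⁰) (b₂ d₂ : R₂⁰) :
    regularPair (b₁ * d₁) (b₂ * d₂) = regularPair b₁ b₂ * regularPair d₁ d₂ := rfl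

theorem regularPair_fst_snd (b : (R₁ × R₂)⁰) :
    regularPair (regularFst b) (regularSnd b) = b := rfl

theorem affine_injective {R : Type*} [Ring R] (a : R) (b : R⁰) :
    Function.Injective fun x => a + b * x := fun x y h => by
  have h1 : (b : R) * (x - y) = 0 := by rw [mul_sub]; exact sub_eq_zero.2 (add_left_cancel h)
  exact sub_eq_zero.1 (b.2.1 _ h1)

theorem affine_image_prod (a : R₁ × R₂) (b : (R₁ × R₂)⁰) (X : Set R₁) (Y : Set R₂) :
    (fun x => a + b * x) '' (X ×ˢ Y) =
      ((fun x => a.1 + (regularFst b : R₁) * x) '' X) ×ˢ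
        ((fun x => a.2 + (regularSnd b : R₂) * x) '' Y) :=
  (Set.prod_image_image_eq (m₁ := fun x => a.1 + (regularFst b : R₁) * x)
    (m₂ := fun x => a.2 + (regularSnd b : R₂) * x)).symm

end RegularPairs

namespace InvariantSetAlgebra

variable {R₁ R₂ : Type*} [Ring R₁] [Ring R₂]

section

variable {C₁ : InvariantSetAlgebra R₁} {C₂ : InvariantSetAlgebra R₂}

theorem rectangle_mem_prod {X : Set R₁} {Y : Set R₂} (hX : X ∈ C₁.sets) (hY : Y ∈ C₂.sets) :
    X ×ˢ Y ∈ (C₁.prod C₂).sets := fun _ hC => hC ⟨X, hX, Y, hY, rfl⟩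

/-- The algebra of sets generated by the rectangles is already invariant. -/
theorem prod_sets : (C₁.prod C₂).sets = MeasureTheory.generateSetAlgebra
    {X | ∃ X₁ ∈ C₁.sets, ∃ X₂ ∈ C₂.sets, X = X₁ ×ˢ X₂} := by
  apply Set.Subset.antisymm
  · intro X hX
    refine hX
      ⟨MeasureTheory.generateSetAlgebra _, MeasureTheory.isSetAlgebra_generateSetAlgebra, ?_⟩
      MeasureTheory.self_subset_generateSetAlgebra
    intro X hX a b hb
    induction hX with
    | base X h =>
      obtain ⟨X₁, h₁, X₂, h₂, rfl⟩ := h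
      refine .base _ ⟨_, C₁.affine_mem X₁ h₁ a.1 b.1 (regularFst ⟨b, hb⟩).2, _,
        C₂.affine_mem X₂ h₂ a.2 b.2 (regularSnd ⟨b, hb⟩).2, affine_image_prod a ⟨b, hb⟩ X₁ X₂⟩
    | empty => rw [Set.image_empty]; exact .empty
    | compl X _ ih =>
      -- The affine map is injective but need not be surjective, so the image of a complement is a
      -- complement relative to the image of the whole ring, which is a rectangle.
      rw [Set.compl_eq_univ_sdiff, Set.image_sdiff (affine_injective a ⟨b, hb⟩)]
      refine MeasureTheory.isSetAlgebra_generateSetAlgebra.sdiff_mem ?_ ih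
      rw [← Set.univ_prod_univ, affine_image_prod a ⟨b, hb⟩]
      exact .base _ ⟨_, C₁.affine_mem _ C₁.isSetAlgebra.univ_mem a.1 b.1 (regularFst ⟨b, hb⟩).2,
        _, C₂.affine_mem _ C₂.isSetAlgebra.univ_mem a.2 b.2 (regularSnd ⟨b, hb⟩).2, rfl⟩
    | union X Y _ _ ihX ihY => rw [Set.image_union]; exact .union _ _ ihX ihY
  · refine MeasureTheory.IsSetAlgebra.generateSetAlgebra_subset ?_ (C₁.prod C₂).isSetAlgebra
    rintro _ ⟨X₁, h₁, X₂, h₂, rfl⟩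
    exact rectangle_mem_prod h₁ h₂

-- Complements and intersections suffice by De Morgan, and ∅ = ∅ × ∅ is a rectangle. This form fits
-- spectral measures, where the two operations become 1 - e and a product.
@[elab_as_elim]
theorem prod_induction {P : ∀ X : Set (R₁ × R₂), X ∈ (C₁.prod C₂).sets → Prop}
    (rect : ∀ X Y (hX : X ∈ C₁.sets) (hY : Y ∈ C₂.sets), P (X ×ˢ Y) (rectangle_mem_prod hX hY))
    (compl : ∀ X hX, P X hX → P Xᶜ ((C₁.prod C₂).isSetAlgebra.compl_mem hX))
    (inter : ∀ X Y hX hY, P X hX → P Y hY → P (X ∩ Y) ((C₁.prod C₂).isSetAlgebra.inter_mem hX hY))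
    {X : Set (R₁ × R₂)} (hX : X ∈ (C₁.prod C₂).sets) : P X hX := by
  have h : X ∈ MeasureTheory.generateSetAlgebra
      {X : Set (R₁ × R₂) | ∃ X₁ ∈ C₁.sets, ∃ X₂ ∈ C₂.sets, X = X₁ ×ˢ X₂} := by
    rwa [← prod_sets]
  -- The motive depends on the membership proof, so membership is carried along through the
  -- induction.
  suffices ∃ h, P X h from this.2
  clear hX
  induction h with
  | base X h =>
    obtain ⟨X₁, h₁, X₂, h₂, rfl⟩ := h
    exact ⟨_, rect _ _ h₁ h₂⟩
  | empty =>
    have h : ∃ h, P _ h :=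
      ⟨_, rect ∅ ∅ C₁.isSetAlgebra.empty_mem C₂.isSetAlgebra.empty_mem⟩
    rwa [Set.prod_empty] at h
  | compl X h ih =>
    obtain ⟨_, ih⟩ := ih
    exact ⟨_, compl _ _ ih⟩
  | union X Y h h' ih ih' =>
    obtain ⟨_, ih⟩ := ih
    obtain ⟨_, ih'⟩ := ih'
    have h : ∃ h, P _ h := ⟨_, compl _ _ (inter _ _ _ _ (compl _ _ ih) (compl _ _ ih'))⟩
    rwa [← Set.compl_union, compl_compl] at h

end

end InvariantSetAlgebra

/-! ### Finitely additive spectral measures -/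

/-- A finitely additive multiplicative measure on the algebra of sets `C` with values in the
ring `M`. -/
structure IsSpectral {R M : Type*} [Ring R] [Ring M] (C : InvariantSetAlgebra R)
    (e : Set R → M) : Prop where
  univ : e Set.univ = 1
  inter : ∀ X ∈ C.sets, ∀ Y ∈ C.sets, e X * e Y = e (X ∩ Y)
  union : ∀ X ∈ C.sets, ∀ Y ∈ C.sets, Disjoint X Y → e (X ∪ Y) = e X + e Y

namespace IsSpectral

section

variable {R M : Type*} [Ring R] [Ring M] {C : InvariantSetAlgebra R} {e : Set R → M}

theorem empty (h : IsSpectral C e) : e ∅ = 0 := by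
  have := h.union ∅ C.isSetAlgebra.empty_mem ∅ C.isSetAlgebra.empty_mem disjoint_bot_left
  simpa using this

theorem compl (h : IsSpectral C e) {X : Set R} (hX : X ∈ C.sets) : e Xᶜ = 1 - e X := by
  have := h.union X hX Xᶜ (C.isSetAlgebra.compl_mem hX) disjoint_compl_right
  rw [Set.union_compl_self, h.univ] at this
  rw [this, add_sub_cancel_left]

/-- By De Morgan, 1 - e (X ∪ Y) = (1 - e X) * (1 - e Y) = 1 - (e X + e Y) + e X * e Y, and the last
product is e ∅ = 0 for disjoint sets. Additivity thus comes for free from complements and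
intersections. -/
theorem of_compl (h₁ : e Set.univ = 1)
    (h₂ : ∀ X ∈ C.sets, ∀ Y ∈ C.sets, e X * e Y = e (X ∩ Y))
    (h₃ : ∀ X ∈ C.sets, e Xᶜ = 1 - e X) : IsSpectral C e where
  univ := h₁
  inter := h₂
  union X hX Y hY hXY := by
    have h0 : e ∅ = 0 := by
      rw [← Set.compl_univ, h₃ _ C.isSetAlgebra.univ_mem, h₁, sub_self]
    have h4 := h₂ _ (C.isSetAlgebra.compl_mem hX) _ (C.isSetAlgebra.compl_mem hY)
    have h5 := h₂ X hX Y hY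
    rw [Set.disjoint_iff_inter_eq_empty.1 hXY, h0] at h5
    rw [← Set.compl_union, h₃ _ (C.isSetAlgebra.union_mem hX hY), h₃ X hX, h₃ Y hY] at h4
    have h6 : (1 - e X) * (1 - e Y) = 1 - (e X + e Y) + e X * e Y := by noncomm_ring
    rw [h6, h5, add_zero] at h4
    exact (sub_right_injective h4).symm

end

section Product

variable {R₁ R₂ M : Type*} [Ring R₁] [Ring R₂] [Ring M] {C₁ : InvariantSetAlgebra R₁}
  {C₂ : InvariantSetAlgebra R₂} {e₁ : Set R₁ → M} {e₂ : Set R₂ → M}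

variable (C₁ C₂ e₁ e₂) in
/-- The value `P` is admissible for the product measure of `X`. -/
def IsProductValue (X : Set (R₁ × R₂)) (P : M) : Prop :=
  ∀ A ∈ C₁.sets, ∀ B ∈ C₂.sets,
    (A ×ˢ B ⊆ X → e₁ A * e₂ B * P = e₁ A * e₂ B) ∧ (A ×ˢ B ⊆ Xᶜ → e₁ A * e₂ B * P = 0)

theorem rectangle_mul (h₁ : IsSpectral C₁ e₁) (h₂ : IsSpectral C₂ e₂)
    (hc : ∀ X ∈ C₁.sets, ∀ Y ∈ C₂.sets, Commute (e₁ X) (e₂ Y)) {A A' : Set R₁} {B B' : Set R₂}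
    (hA : A ∈ C₁.sets) (hA' : A' ∈ C₁.sets) (hB : B ∈ C₂.sets) (hB' : B' ∈ C₂.sets) :
    e₁ A * e₂ B * (e₁ A' * e₂ B') = e₁ (A ∩ A') * e₂ (B ∩ B') := by
  rw [← h₁.inter A hA A' hA', ← h₂.inter B hB B' hB', (hc A' hA' B hB).symm.mul_mul_mul_comm]

/-- The three rectangles partition R₁ × R₂; the first is A × B and the other two lie outside it.
This is the base case of `eq_zero_of_rectangle_mul`. -/
theorem rectangle_sum (h₁ : IsSpectral C₁ e₁) (h₂ : IsSpectral C₂ e₂) {A : Set R₁} {B : Set R₂}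
    (hA : A ∈ C₁.sets) (hB : B ∈ C₂.sets) :
    e₁ A * e₂ B + e₁ A * e₂ Bᶜ + e₁ Aᶜ * e₂ Set.univ = 1 := by
  rw [h₁.compl hA, h₂.compl hB, h₂.univ]
  noncomm_ring

/-- An element that is annihilated by all rectangles inside `X` and outside `X` vanishes. -/
theorem eq_zero_of_rectangle_mul (h₁ : IsSpectral C₁ e₁) (h₂ : IsSpectral C₂ e₂)
    (hc : ∀ X ∈ C₁.sets, ∀ Y ∈ C₂.sets, Commute (e₁ X) (e₂ Y)) {X : Set (R₁ × R₂)}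
    (hX : X ∈ (C₁.prod C₂).sets) (z : M)
    (hz : ∀ A ∈ C₁.sets, ∀ B ∈ C₂.sets, A ×ˢ B ⊆ X ∨ A ×ˢ B ⊆ Xᶜ → e₁ A * e₂ B * z = 0) :
    z = 0 := by
  -- `z` must vary: in the intersection case the hypothesis for Y is applied to `e₁ A * e₂ B * z`.
  induction hX using InvariantSetAlgebra.prod_induction generalizing z with
  | rect A B hA hB =>
    rw [← one_mul z, ← rectangle_sum h₁ h₂ hA hB, add_mul, add_mul, hz A hA B hB (.inl subset_rfl),
      hz A hA _ (C₂.isSetAlgebra.compl_mem hB) (.inr ?_),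
      hz _ (C₁.isSetAlgebra.compl_mem hA) _ C₂.isSetAlgebra.univ_mem (.inr ?_), add_zero, add_zero]
    · exact fun x hx hx' => hx.1 hx'.1
    · exact fun x hx hx' => hx.2 hx'.2
  | compl X hX ih =>
    refine ih z fun A hA B hB h => hz A hA B hB ?_
    rw [compl_compl]
    exact h.symm
  | inter X Y hX hY ihX ihY =>
    -- A rectangle outside X is outside X ∩ Y. One inside X is cut by the test rectangles of Y, and
    -- each piece lies inside or outside X ∩ Y.
    refine ihX z fun A hA B hB h => ?_
    rcases h with h | h
    · refine ihY _ fun A' hA' B' hB' h' => ?_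
      rw [← mul_assoc, rectangle_mul h₁ h₂ hc hA' hA hB' hB]
      refine hz _ (C₁.isSetAlgebra.inter_mem hA' hA) _ (C₂.isSetAlgebra.inter_mem hB' hB) ?_
      rw [← Set.prod_inter_prod]
      rcases h' with h' | h'
      · exact .inl fun x hx => ⟨h hx.2, h' hx.1⟩
      · exact .inr fun x hx hx' => h' hx.1 hx'.2
    · exact hz A hA B hB (.inr fun x hx hx' => h hx hx'.1)

/-- Every test rectangle annihilates P - Q. All identities for the product measure are derived from
this. -/
theorem IsProductValue.unique (h₁ : IsSpectral C₁ e₁) (h₂ : IsSpectral C₂ e₂)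
    (hc : ∀ X ∈ C₁.sets, ∀ Y ∈ C₂.sets, Commute (e₁ X) (e₂ Y)) {X : Set (R₁ × R₂)}
    (hX : X ∈ (C₁.prod C₂).sets) {P Q : M} (hP : IsProductValue C₁ C₂ e₁ e₂ X P)
    (hQ : IsProductValue C₁ C₂ e₁ e₂ X Q) : P = Q := by
  refine sub_eq_zero.1 (eq_zero_of_rectangle_mul h₁ h₂ hc hX _ fun A hA B hB h => ?_)
  rw [mul_sub, sub_eq_zero]
  rcases h with h | h
  · rw [(hP A hA B hB).1 h, (hQ A hA B hB).1 h]
  · rw [(hP A hA B hB).2 h, (hQ A hA B hB).2 h]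

theorem isProductValue_rectangle (h₁ : IsSpectral C₁ e₁) (h₂ : IsSpectral C₂ e₂)
    (hc : ∀ X ∈ C₁.sets, ∀ Y ∈ C₂.sets, Commute (e₁ X) (e₂ Y)) {A : Set R₁} {B : Set R₂}
    (hA : A ∈ C₁.sets) (hB : B ∈ C₂.sets) :
    IsProductValue C₁ C₂ e₁ e₂ (A ×ˢ B) (e₁ A * e₂ B) := by
  -- Equal rectangles have equal sides unless they are empty; in that case each has an empty side
  -- and both products vanish.
  have key : ∀ (A A' : Set R₁) (B B' : Set R₂), A ×ˢ B = A' ×ˢ B' →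
      e₁ A * e₂ B = e₁ A' * e₂ B' := by
    intro A A' B B' h
    rcases Set.prod_eq_prod_iff.1 h with ⟨rfl, rfl⟩ | ⟨h, h'⟩
    · rfl
    · rcases h with rfl | rfl <;> rcases h' with rfl | rfl <;>
        simp only [h₁.empty, h₂.empty, zero_mul, mul_zero]
  intro A' hA' B' hB'
  rw [rectangle_mul h₁ h₂ hc hA' hA hB' hB]
  refine ⟨fun h => key _ _ _ _ ?_, fun h => (key _ ∅ _ ∅ ?_).trans ?_⟩
  · rw [← Set.prod_inter_prod, Set.inter_eq_left.2 h]
  · rw [← Set.prod_inter_prod, Set.prod_empty]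
    exact Set.disjoint_iff_inter_eq_empty.1 (Set.disjoint_left.2 h)
  · rw [h₁.empty, zero_mul]

theorem IsProductValue.compl {X : Set (R₁ × R₂)} {P : M}
    (hP : IsProductValue C₁ C₂ e₁ e₂ X P) : IsProductValue C₁ C₂ e₁ e₂ Xᶜ (1 - P) := by
  intro A hA B hB
  refine ⟨fun h => ?_, fun h => ?_⟩
  · rw [mul_sub, (hP A hA B hB).2 h, mul_one, sub_zero]
  · rw [mul_sub, (hP A hA B hB).1 (by rwa [compl_compl] at h), mul_one, sub_self]

theorem IsProductValue.inter (h₁ : IsSpectral C₁ e₁) (h₂ : IsSpectral C₂ e₂)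
    (hc : ∀ X ∈ C₁.sets, ∀ Y ∈ C₂.sets, Commute (e₁ X) (e₂ Y)) {X Y : Set (R₁ × R₂)}
    (hX : X ∈ (C₁.prod C₂).sets) {P Q : M} (hP : IsProductValue C₁ C₂ e₁ e₂ X P)
    (hQ : IsProductValue C₁ C₂ e₁ e₂ Y Q) :
    IsProductValue C₁ C₂ e₁ e₂ (X ∩ Y) (P * Q) := by
  intro A hA B hB
  refine ⟨fun h => ?_, fun h => ?_⟩
  · rw [← mul_assoc, (hP A hA B hB).1 (h.trans Set.inter_subset_left),
      (hQ A hA B hB).1 (h.trans Set.inter_subset_right)]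
  -- A rectangle disjoint from X ∩ Y may still meet both X and Y, so it is cut by the test
  -- rectangles of X. On a piece inside X, P acts as 1 and Q annihilates, since the piece is outside
  -- Y; on a piece outside X, P annihilates.
  · refine eq_zero_of_rectangle_mul h₁ h₂ hc hX _ fun A' hA' B' hB' h' => ?_
    rw [← mul_assoc, ← mul_assoc, rectangle_mul h₁ h₂ hc hA' hA hB' hB]
    have hA'' := C₁.isSetAlgebra.inter_mem hA' hA
    have hB'' := C₂.isSetAlgebra.inter_mem hB' hB
    rcases h' with h' | h'
    · rw [(hP _ hA'' _ hB'').1, (hQ _ hA'' _ hB'').2]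
      · rw [← Set.prod_inter_prod]
        exact fun x hx hx' => h hx.2 ⟨h' hx.1, hx'⟩
      · rw [← Set.prod_inter_prod]
        exact Set.inter_subset_left.trans h'
    · rw [(hP _ hA'' _ hB'').2, zero_mul]
      rw [← Set.prod_inter_prod]
      exact Set.inter_subset_left.trans h'

/-- Two commuting finitely additive spectral measures have a product. -/
theorem exists_prod (h₁ : IsSpectral C₁ e₁) (h₂ : IsSpectral C₂ e₂)
    (hc : ∀ X ∈ C₁.sets, ∀ Y ∈ C₂.sets, Commute (e₁ X) (e₂ Y)) :
    ∃ e : Set (R₁ × R₂) → M, IsSpectral (C₁.prod C₂) e ∧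
      ∀ X ∈ C₁.sets, ∀ Y ∈ C₂.sets, e (X ×ˢ Y) = e₁ X * e₂ Y := by
  -- Membership is placed under the quantifier so that choice yields a function on all sets; its
  -- values off the algebra are irrelevant.
  have hex : ∀ X : Set (R₁ × R₂), ∃ P : M, X ∈ (C₁.prod C₂).sets →
      IsProductValue C₁ C₂ e₁ e₂ X P := by
    intro X
    by_cases hX : X ∈ (C₁.prod C₂).sets
    · suffices ∃ P, IsProductValue C₁ C₂ e₁ e₂ X P from this.imp fun P hP _ => hP
      induction hX using InvariantSetAlgebra.prod_induction with
      | rect A B hA hB => exact ⟨_, isProductValue_rectangle h₁ h₂ hc hA hB⟩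
      | compl X hX ih => exact ih.imp' _ fun _ hP => hP.compl
      | inter X Y hX hY ihX ihY =>
        obtain ⟨P, hP⟩ := ihX
        obtain ⟨Q, hQ⟩ := ihY
        exact ⟨_, hP.inter h₁ h₂ hc hX hQ⟩
    · exact ⟨0, fun h => (hX h).elim⟩
  choose e he using hex
  have hrect : ∀ X ∈ C₁.sets, ∀ Y ∈ C₂.sets, e (X ×ˢ Y) = e₁ X * e₂ Y := fun X hX Y hY =>
    have h := InvariantSetAlgebra.rectangle_mem_prod hX hY
    (he _ h).unique h₁ h₂ hc h (isProductValue_rectangle h₁ h₂ hc hX hY)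
  refine ⟨e, .of_compl ?_ (fun X hX Y hY => ?_) fun X hX => ?_, hrect⟩
  · rw [← Set.univ_prod_univ, hrect _ C₁.isSetAlgebra.univ_mem _ C₂.isSetAlgebra.univ_mem, h₁.univ,
      h₂.univ, one_mul]
  · have h := (C₁.prod C₂).isSetAlgebra.inter_mem hX hY
    exact ((he X hX).inter h₁ h₂ hc hX (he Y hY)).unique h₁ h₂ hc h (he _ h)
  · have h := (C₁.prod C₂).isSetAlgebra.compl_mem hX
    exact (he _ h).unique h₁ h₂ hc h (he X hX).compl

end Product

end IsSpectral

/-! ### Universal properties -/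

theorem StarAlgHom.continuous_of_cstarAlgebra {A B : Type*} [CStarAlgebra A] [CStarAlgebra B]
    (f : A →⋆ₐ[ℂ] B) : Continuous f :=
  AddMonoidHomClass.continuous_of_bound f 1 fun x => by
    rw [one_mul]
    exact NonUnitalStarAlgHom.norm_apply_le f x

namespace CStarSeminorm

section Lift

variable {F : Type*} [Ring F] [StarRing F] [Algebra ℂ F] {M : Type*} [CStarAlgebra M]

/-- The C*-seminorm defined by a *-homomorphism to a C*-algebra. -/
def ofStarAlgHom (f : F →⋆ₐ[ℂ] M) : CStarSeminorm F where
  toFun x := ‖f x‖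
  map_zero' := by rw [map_zero, norm_zero]
  add_le' x y := by rw [map_add]; exact norm_add_le _ _
  neg' x := by rw [map_neg, norm_neg]
  smul' c x := by rw [map_smul, norm_smul]
  mul_le' x y := by rw [map_mul]; exact norm_mul_le _ _
  star_mul_self' x := by rw [map_mul, map_star, CStarRing.norm_star_mul_self]

theorem le_universal {rel : F → F → Prop} (h : ∀ x, BddAbove (values rel x))
    (p : CStarSeminorm F) (hp : p.Satisfies rel) (x : F) : p x ≤ universal rel h x :=
  le_csSup (h x) ⟨⟨p, hp⟩, rfl⟩

theorem universal_satisfies {rel : F → F → Prop} (h : ∀ x, BddAbove (values rel x)) :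
    (universal rel h).Satisfies rel := fun x y hxy => by
  refine le_antisymm (csSup_le ⟨_, ⟨0, zero_satisfies rel⟩, rfl⟩ ?_) (nonneg _ _)
  rintro _ ⟨p, rfl⟩
  exact (p.2 x y hxy).le

variable (p : CStarSeminorm F)

theorem toCompletion_one : p.toCompletion 1 = 1 := rfl

theorem toCompletion_sub (x y : F) :
    p.toCompletion (x - y) = p.toCompletion x - p.toCompletion y :=
  UniformSpace.Completion.coe_sub (α := p.Pre) x y

theorem toCompletion_eq {x y : F} (h : p (x - y) = 0) : p.toCompletion x = p.toCompletion y := by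
  rw [← sub_eq_zero, ← toCompletion_sub, ← norm_eq_zero, norm_toCompletion, h]

/-- The canonical map to the completion as a *-homomorphism. -/
def toCompletionHom : F →⋆ₐ[ℂ] p.Completion where
  toFun := p.toCompletion
  map_one' := rfl
  map_mul' := p.toCompletion_mul
  map_zero' := rfl
  map_add' := p.toCompletion_add
  commutes' c := by
    rw [Algebra.algebraMap_eq_smul_one, toCompletion_smul, toCompletion_one,
      Algebra.algebraMap_eq_smul_one]
  map_star' x := (p.star_toCompletion x).symm

/-- The continuous extension of a map on `F` to the completion. -/
def extend (f : F → M) : p.Completion → M := UniformSpace.Completion.extension (α := p.Pre) f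

theorem continuous_extend (f : F → M) : Continuous (p.extend f) :=
  UniformSpace.Completion.continuous_extension

/-- The bound makes f uniformly continuous for the seminorm p; this is what makes the extension
agree with f on F. -/
theorem extend_toCompletion (f : F →⋆ₐ[ℂ] M) (hf : ∀ x, ‖f x‖ ≤ p x) (x : F) :
    p.extend f (p.toCompletion x) = f x := by
  let g : p.Pre →+ M := AddMonoidHomClass.toAddMonoidHom f
  have hg : UniformContinuous g :=
    AddMonoidHomClass.uniformContinuous_of_bound g 1 fun x => (hf x).trans (one_mul _).ge
  exact UniformSpace.Completion.extension_coe hg x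

/-- The *-homomorphism on the completion induced by a bounded *-homomorphism on `F`. -/
def lift (f : F →⋆ₐ[ℂ] M) (hf : ∀ x, ‖f x‖ ≤ p x) : p.Completion →⋆ₐ[ℂ] M where
  toFun := p.extend f
  map_one' := by rw [← toCompletion_one, extend_toCompletion p f hf, map_one]
  map_zero' := (p.extend_toCompletion f hf 0).trans (map_zero f)
  map_mul' := p.completion_induction₂
    (isClosed_eq ((p.continuous_extend f).comp (continuous_fst.mul continuous_snd))
      (((p.continuous_extend f).comp continuous_fst).mul
        ((p.continuous_extend f).comp continuous_snd)))
    fun x y => by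
      rw [← toCompletion_mul, extend_toCompletion p f hf, extend_toCompletion p f hf,
        extend_toCompletion p f hf, map_mul]
  map_add' := p.completion_induction₂
    (isClosed_eq ((p.continuous_extend f).comp (continuous_fst.add continuous_snd))
      (((p.continuous_extend f).comp continuous_fst).add
        ((p.continuous_extend f).comp continuous_snd)))
    fun x y => by
      rw [← toCompletion_add, extend_toCompletion p f hf, extend_toCompletion p f hf,
        extend_toCompletion p f hf, map_add]
  commutes' c := by
    rw [Algebra.algebraMap_eq_smul_one, ← toCompletion_one, ← toCompletion_smul,
      extend_toCompletion p f hf, map_smul, map_one, Algebra.algebraMap_eq_smul_one]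
  map_star' := p.completion_induction
    (isClosed_eq ((p.continuous_extend f).comp p.continuous_star_completion)
      (continuous_star.comp (p.continuous_extend f)))
    fun x => by
      rw [star_toCompletion, extend_toCompletion p f hf, extend_toCompletion p f hf, map_star]

theorem lift_toCompletion (f : F →⋆ₐ[ℂ] M) (hf : ∀ x, ‖f x‖ ≤ p x) (x : F) :
    p.lift f hf (p.toCompletion x) = f x := p.extend_toCompletion f hf x

/-- The *-homomorphism on a universal C*-algebra induced by a *-homomorphism that satisfies the
relations. -/
def universalLift {rel : F → F → Prop} (h : ∀ x, BddAbove (values rel x)) (f : F →⋆ₐ[ℂ] M)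
    (hf : ∀ x y, rel x y → f x = f y) : (universal rel h).Completion →⋆ₐ[ℂ] M :=
  -- x ↦ ‖f x‖ is itself one of the seminorms in the supremum, which gives the required bound.
  (universal rel h).lift f fun x => le_universal h (ofStarAlgHom f) (fun x y hxy => by
    change ‖f (x - y)‖ = 0
    rw [map_sub, hf x y hxy, sub_self, norm_zero]) x

theorem universalLift_toCompletion {rel : F → F → Prop} (h : ∀ x, BddAbove (values rel x))
    (f : F →⋆ₐ[ℂ] M) (hf : ∀ x y, rel x y → f x = f y) (x : F) :
    universalLift h f hf ((universal rel h).toCompletion x) = f x :=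
  lift_toCompletion _ f _ x

variable [StarModule ℂ F]

/-- Two *-homomorphisms on a completion that agree on `F` are equal. -/
theorem starAlgHom_ext {f g : p.Completion →⋆ₐ[ℂ] M}
    (h : ∀ x, f (p.toCompletion x) = g (p.toCompletion x)) : f = g :=
  StarAlgHom.ext <| p.completion_induction
    (isClosed_eq f.continuous_of_cstarAlgebra g.continuous_of_cstarAlgebra) h

/-- A closed star subalgebra that contains the image of `F` contains the image of the
completion. -/
theorem starAlgHom_mem (f : p.Completion →⋆ₐ[ℂ] M) {T : StarSubalgebra ℂ M}
    (hT : IsClosed (T : Set M)) (h : ∀ x, f (p.toCompletion x) ∈ T) (x : p.Completion) :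
    f x ∈ T :=
  p.completion_induction (P := fun x => f x ∈ T) (hT.preimage (f.continuous_of_cstarAlgebra)) h x

end Lift

end CStarSeminorm

namespace FreeStarAlgebra

section Lift

variable {G : Type*} {M : Type*} [Ring M] [StarRing M]

/-- The homomorphism on words that extends a map on letters. -/
def liftWord (f : G → M) : StarWord G →* M :=
  FreeMonoid.lift fun l : G × Bool => if l.2 then star (f l.1) else f l.1

theorem liftWord_of (f : G → M) (l : G × Bool) :
    liftWord f (FreeMonoid.of l) = if l.2 then star (f l.1) else f l.1 :=
  FreeMonoid.lift_eval_of _ l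

theorem liftWord_star (f : G → M) (w : StarWord G) :
    liftWord f (star w) = star (liftWord f w) := by
  induction w using FreeMonoid.inductionOn' with
  | one =>
    change liftWord f (star (1 : StarWord G)) = star (liftWord f (1 : StarWord G))
    rw [star_one, map_one, star_one]
  | of_mul l w ih =>
    -- The product is restated in `StarWord G`, which carries the star; the induction delivers it in
    -- `FreeMonoid`.
    have h : ∀ v v' : StarWord G, v = FreeMonoid.of l → v' = w →
        liftWord f (star (v * v')) = star (liftWord f (v * v')) := by
      rintro v v' hv rfl
      have hs : star v = FreeMonoid.of (l.1, !l.2) := by rw [hv]; rfl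
      rw [star_mul, map_mul, map_mul, ih, star_mul, hs, hv, liftWord_of, liftWord_of]
      obtain ⟨g, b⟩ := l
      cases b <;> simp
    exact h _ _ rfl rfl

variable [Algebra ℂ M]

/-- The algebra homomorphism that extends a map on generators. -/
def liftAlgHom (f : G → M) : FreeStarAlgebra G →ₐ[ℂ] M :=
  MonoidAlgebra.lift ℂ M (StarWord G) (liftWord f)

theorem liftAlgHom_monomial (f : G → M) (w : StarWord G) (c : ℂ) :
    liftAlgHom f (monomial w c) = c • liftWord f w :=
  MonoidAlgebra.lift_single (liftWord f) w c

/-- The *-homomorphism on the free *-algebra that extends a map on generators. -/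
def lift [StarModule ℂ M] (f : G → M) : FreeStarAlgebra G →⋆ₐ[ℂ] M :=
  { liftAlgHom f with
    map_star' := fun x => by
      change liftAlgHom f (star x) = star (liftAlgHom f x)
      induction x using induction with
      | zero => simp
      | add x y hx hy => rw [star_add, map_add, map_add, star_add, hx, hy]
      | mon w c =>
        rw [star_monomial, liftAlgHom_monomial, liftAlgHom_monomial, liftWord_star, star_smul] }

theorem lift_of [StarModule ℂ M] (f : G → M) (g : G) : lift f (of g) = f g := by
  refine (liftAlgHom_monomial f _ 1).trans ?_
  rw [one_smul]
  exact liftWord_of f (g, false)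

/-- A star subalgebra that contains the images of all generators contains the image of every
element. -/
theorem starAlgHom_mem [StarModule ℂ M] (φ : FreeStarAlgebra G →⋆ₐ[ℂ] M) {T : StarSubalgebra ℂ M}
    (h : ∀ g, φ (of g) ∈ T) (x : FreeStarAlgebra G) : φ x ∈ T := by
  induction x using induction with
  | zero => rw [map_zero]; exact zero_mem T
  | add x y hx hy => rw [map_add]; exact add_mem hx hy
  | mon w c =>
    have hw : φ (monomial w 1) ∈ T := by
      induction w using FreeMonoid.inductionOn' with
      | one => exact (map_one φ).symm ▸ one_mem T
      | of_mul l w ih =>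
        have h2 : φ (monomial (FreeMonoid.of l) 1) ∈ T := by
          obtain ⟨g, b⟩ := l
          cases b with
          | false => exact h g
          | true =>
            have h3 := star_mem (h g)
            rwa [← map_star, of, star_monomial, star_one] at h3
        have h4 := monomial_mul (G := G) (FreeMonoid.of l) w 1 1
        rw [one_mul] at h4
        have h5 := mul_mem h2 ih
        rw [← map_mul, h4] at h5
        exact h5
    have h5 := T.smul_mem hw c
    rwa [← map_smul, smul_monomial, mul_one] at h5

end Lift

end FreeStarAlgebra

/-! ### Representations of the defining relations -/

/-- A family of elements of `M` that satisfies the defining relations of the full ring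
C*-algebra. -/
structure RingRepresentation {R : Type*} [Ring R] (C : InvariantSetAlgebra R) (M : Type*) [Ring M]
    [StarRing M] where
  e : Set R → M
  u : R → M
  s : R⁰ → M
  spectral : IsSpectral C e
  e_star : ∀ X ∈ C.sets, star (e X) = e X
  u_star_mul : ∀ a, star (u a) * u a = 1
  u_mul_star : ∀ a, u a * star (u a) = 1
  s_star_mul : ∀ b, star (s b) * s b = 1
  u_zero : u 0 = 1
  affine_mul : ∀ a c b d, u a * s b * (u c * s d) = u (a + b * c) * s (b * d)
  affine_e : ∀ a b, ∀ X ∈ C.sets,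
    u a * s b * e X * star (u a * s b) = e ((fun x => a + b * x) '' X)

namespace RingRepresentation

open InvariantSetAlgebra (rectangle_mem_prod)

section

variable {R : Type*} [Ring R] {C : InvariantSetAlgebra R}

section

variable {M : Type*} [Ring M] [StarRing M] (ρ : RingRepresentation C M)

/-- The relations normalise u^0 but not s_1. They make s_1 idempotent, and an idempotent isometry is
1 by left cancellation. -/
theorem s_one : ρ.s 1 = 1 := by
  have h := ρ.affine_mul 0 0 1 1
  simp only [ρ.u_zero, one_mul, mul_zero, add_zero, mul_one] at h
  have h1 := ρ.s_star_mul 1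
  rw [← h1]
  nth_rewrite 3 [← h]
  rw [← mul_assoc, h1, one_mul]

theorem u_add (a c : R) : ρ.u (a + c) = ρ.u a * ρ.u c := by
  have h := ρ.affine_mul a c 1 1
  simpa [ρ.s_one] using h.symm

theorem s_mul (b d : R⁰) : ρ.s (b * d) = ρ.s b * ρ.s d := by
  have h := ρ.affine_mul 0 0 b d
  simpa [ρ.u_zero] using h.symm

theorem star_affine_mul (a : R) (b : R⁰) :
    star (ρ.u a * ρ.s b) * (ρ.u a * ρ.s b) = 1 := by
  rw [star_mul, mul_assoc, ← mul_assoc (star (ρ.u a)), ρ.u_star_mul, one_mul, ρ.s_star_mul]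

end

section Universal

variable {M : Type*} [CStarAlgebra M] (ρ : RingRepresentation C M)

/-- The values of a representation on the generators. -/
def generatorMap : RingGenerator C → M
  | .e X _ => ρ.e X
  | .u a => ρ.u a
  | .s b => ρ.s b

/-- The *-homomorphism on the full ring C*-algebra induced by a representation of the
relations. -/
def lift : FullRingCStarAlgebra C →⋆ₐ[ℂ] M :=
  CStarSeminorm.universalLift (RingGenerator.bddAbove_values C)
    (FreeStarAlgebra.lift ρ.generatorMap) fun x y h => by
      have hE : ∀ X hX, FreeStarAlgebra.lift ρ.generatorMap (RingGenerator.E C X hX) = ρ.e X :=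
        fun X hX => FreeStarAlgebra.lift_of _ _
      have hU : ∀ a, FreeStarAlgebra.lift ρ.generatorMap (RingGenerator.U C a) = ρ.u a :=
        fun a => FreeStarAlgebra.lift_of _ _
      have hS : ∀ b, FreeStarAlgebra.lift ρ.generatorMap (RingGenerator.S C b) = ρ.s b :=
        fun b => FreeStarAlgebra.lift_of _ _
      cases h with
      | e_star X hX => rw [map_star, hE, ρ.e_star X hX]
      | e_idem X hX => rw [map_mul, hE, ρ.spectral.inter X hX X hX, Set.inter_self]
      | u_star_mul a => rw [map_mul, map_star, hU, ρ.u_star_mul, map_one]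
      | u_mul_star a => rw [map_mul, map_star, hU, ρ.u_mul_star, map_one]
      | s_star_mul b => rw [map_mul, map_star, hS, ρ.s_star_mul, map_one]
      | u_zero => rw [hU, ρ.u_zero, map_one]
      | affine_mul a c b d => simp only [map_mul, hU, hS, ρ.affine_mul]
      | affine_e a b X hX => simp only [map_mul, map_star, hU, hS, hE, ρ.affine_e a b X hX]
      | e_univ => rw [hE, ρ.spectral.univ, map_one]
      | e_inter X Y hX hY => rw [map_mul, hE, hE, hE, ρ.spectral.inter X hX Y hY]
      | e_disjoint_union X Y hX hY hXY =>
        rw [map_add, hE, hE, hE, ρ.spectral.union X hX Y hY hXY]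

variable (C) in
open Classical in
/-- The canonical generators of the full ring C*-algebra. -/
def canonical : RingRepresentation C (FullRingCStarAlgebra C) :=
  let q := CStarSeminorm.universal (RingGenerator.Rel C) (RingGenerator.bddAbove_values C)
  have hq : ∀ {x y}, RingGenerator.Rel C x y → q.toCompletionHom x = q.toCompletionHom y :=
    fun h => q.toCompletion_eq (CStarSeminorm.universal_satisfies _ _ _ h)
  have he : ∀ X (hX : X ∈ C.sets), (if hX : X ∈ C.sets then
      q.toCompletionHom (RingGenerator.E C X hX) else 0) =
        q.toCompletionHom (RingGenerator.E C X hX) := fun X hX => dif_pos hX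
  -- The value 0 off `C.sets` is a mere default: every relation is tested only on members of C.
  { e := fun X => if hX : X ∈ C.sets then q.toCompletionHom (RingGenerator.E C X hX) else 0
    u := fun a => q.toCompletionHom (RingGenerator.U C a)
    s := fun b => q.toCompletionHom (RingGenerator.S C b)
    spectral :=
      { univ := by rw [he _ C.isSetAlgebra.univ_mem, hq .e_univ, map_one]
        inter := fun X hX Y hY => by
          rw [he X hX, he Y hY, he _ (C.isSetAlgebra.inter_mem hX hY), ← map_mul,
            hq (.e_inter X Y hX hY)]
        union := fun X hX Y hY hXY => by
          rw [he X hX, he Y hY, he _ (C.isSetAlgebra.union_mem hX hY), ← map_add,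
            hq (.e_disjoint_union X Y hX hY hXY)] }
    e_star := fun X hX => by rw [he X hX, ← map_star, hq (.e_star X hX)]
    u_star_mul := fun a => by rw [← map_star, ← map_mul, hq (.u_star_mul a), map_one]
    u_mul_star := fun a => by rw [← map_star, ← map_mul, hq (.u_mul_star a), map_one]
    s_star_mul := fun b => by rw [← map_star, ← map_mul, hq (.s_star_mul b), map_one]
    u_zero := by rw [hq .u_zero, map_one]
    affine_mul := fun a c b d => by simp only [← map_mul]; exact hq (.affine_mul a c b d)
    affine_e := fun a b X hX => by
      rw [he X hX, he _ (C.affine_mem X hX a b b.2), ← map_mul, ← map_mul, ← map_star, ← map_mul]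
      exact hq (.affine_e a b X hX) }

theorem canonical_e {X : Set R} (hX : X ∈ C.sets) : (canonical C).e X =
    (CStarSeminorm.universal (RingGenerator.Rel C) (RingGenerator.bddAbove_values C)).toCompletion
      (RingGenerator.E C X hX) := dif_pos hX

theorem lift_e {X : Set R} (hX : X ∈ C.sets) : ρ.lift ((canonical C).e X) = ρ.e X := by
  rw [canonical_e hX]
  exact (CStarSeminorm.universalLift_toCompletion _ _ _ _).trans (FreeStarAlgebra.lift_of _ _)

theorem lift_u (a : R) : ρ.lift ((canonical C).u a) = ρ.u a :=
  (CStarSeminorm.universalLift_toCompletion _ _ _ _).trans (FreeStarAlgebra.lift_of _ _)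

theorem lift_s (b : R⁰) : ρ.lift ((canonical C).s b) = ρ.s b :=
  (CStarSeminorm.universalLift_toCompletion _ _ _ _).trans (FreeStarAlgebra.lift_of _ _)

/-- A closed star subalgebra that contains the images of the canonical generators contains the
image of a *-homomorphism on the full ring C*-algebra. -/
theorem starAlgHom_mem (f : FullRingCStarAlgebra C →⋆ₐ[ℂ] M) {T : StarSubalgebra ℂ M}
    (hT : IsClosed (T : Set M)) (he : ∀ X ∈ C.sets, f ((canonical C).e X) ∈ T)
    (hu : ∀ a, f ((canonical C).u a) ∈ T) (hs : ∀ b, f ((canonical C).s b) ∈ T)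
    (x : FullRingCStarAlgebra C) : f x ∈ T := by
  refine CStarSeminorm.starAlgHom_mem _ f hT (fun x => ?_) x
  refine FreeStarAlgebra.starAlgHom_mem (f.comp (CStarSeminorm.toCompletionHom _)) (fun g => ?_) x
  cases g with
  | e X hX =>
    have h := he X hX
    rwa [canonical_e hX] at h
  | u a => exact hu a
  | s b => exact hs b

/-- The equalizer of f and g is a closed star subalgebra, so it is everything once it contains the
generators. -/
theorem starAlgHom_ext {f g : FullRingCStarAlgebra C →⋆ₐ[ℂ] M}
    (he : ∀ X ∈ C.sets, f ((canonical C).e X) = g ((canonical C).e X))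
    (hu : ∀ a, f ((canonical C).u a) = g ((canonical C).u a))
    (hs : ∀ b, f ((canonical C).s b) = g ((canonical C).s b)) : f = g := by
  have h := starAlgHom_mem (StarAlgHom.id ℂ (FullRingCStarAlgebra C))
    (T := StarAlgHom.equalizer f g)
    (isClosed_eq f.continuous_of_cstarAlgebra g.continuous_of_cstarAlgebra) he hu hs
  exact StarAlgHom.ext h

end Universal

end

end RingRepresentation

/-! ### The universal property of the maximal tensor product -/

namespace MaxTensorProduct

variable {A B M : Type*} [CStarAlgebra A] [CStarAlgebra B] [CStarAlgebra M]

variable (A B) in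
/-- The canonical *-homomorphism from the algebraic to the maximal tensor product. -/
def ofTensor : A ⊗[ℂ] B →⋆ₐ[ℂ] MaxTensorProduct A B := CStarSeminorm.toCompletionHom _

variable (A B) in
/-- The canonical *-homomorphism from the left factor to the maximal tensor product. -/
def inl : A →⋆ₐ[ℂ] MaxTensorProduct A B :=
  (ofTensor A B).comp
    { (Algebra.TensorProduct.includeLeft : A →ₐ[ℂ] A ⊗[ℂ] B) with
      map_star' := fun a => by
        change star a ⊗ₜ[ℂ] (1 : B) = star (a ⊗ₜ[ℂ] (1 : B))
        rw [TensorProduct.star_tmul, star_one] }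

variable (A B) in
/-- The canonical *-homomorphism from the right factor to the maximal tensor product. -/
def inr : B →⋆ₐ[ℂ] MaxTensorProduct A B :=
  (ofTensor A B).comp
    { (Algebra.TensorProduct.includeRight : B →ₐ[ℂ] A ⊗[ℂ] B) with
      map_star' := fun b => by
        change (1 : A) ⊗ₜ[ℂ] star b = star ((1 : A) ⊗ₜ[ℂ] b)
        rw [TensorProduct.star_tmul, star_one] }

theorem inl_mul_inr (a : A) (b : B) : inl A B a * inr A B b = ofTensor A B (a ⊗ₜ b) := by
  change ofTensor A B (a ⊗ₜ 1) * ofTensor A B (1 ⊗ₜ b) = _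
  rw [← map_mul, Algebra.TensorProduct.tmul_mul_tmul, mul_one, one_mul]

theorem commute_inl_inr (a : A) (b : B) : Commute (inl A B a) (inr A B b) := by
  rw [Commute, SemiconjBy, inl_mul_inr]
  change _ = ofTensor A B (1 ⊗ₜ b) * ofTensor A B (a ⊗ₜ 1)
  rw [← map_mul, Algebra.TensorProduct.tmul_mul_tmul, mul_one, one_mul]

/-- The *-homomorphism on the algebraic tensor product defined by two commuting
*-homomorphisms. -/
def liftTensor (f : A →⋆ₐ[ℂ] M) (g : B →⋆ₐ[ℂ] M) (hc : ∀ a b, Commute (f a) (g b)) :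
    A ⊗[ℂ] B →⋆ₐ[ℂ] M :=
  { Algebra.TensorProduct.lift (f : A →ₐ[ℂ] M) (g : B →ₐ[ℂ] M) hc with
    map_star' := fun x => by
      change Algebra.TensorProduct.lift (f : A →ₐ[ℂ] M) (g : B →ₐ[ℂ] M) hc (star x) =
        star (Algebra.TensorProduct.lift (f : A →ₐ[ℂ] M) (g : B →ₐ[ℂ] M) hc x)
      induction x with
      | zero => simp
      | add x y hx hy => rw [star_add, map_add, map_add, star_add, hx, hy]
      | tmul a b =>
        rw [TensorProduct.star_tmul, Algebra.TensorProduct.lift_tmul,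
          Algebra.TensorProduct.lift_tmul, star_mul]
        change f (star a) * g (star b) = star (g b) * star (f a)
        rw [hc, map_star, map_star] }

/-- The *-homomorphism on the maximal tensor product defined by two commuting
*-homomorphisms. -/
def lift (f : A →⋆ₐ[ℂ] M) (g : B →⋆ₐ[ℂ] M) (hc : ∀ a b, Commute (f a) (g b)) :
    MaxTensorProduct A B →⋆ₐ[ℂ] M :=
  CStarSeminorm.universalLift (bddAbove_values_tensor A B) (liftTensor f g hc) fun _ _ => False.elim

theorem lift_ofTensor (f : A →⋆ₐ[ℂ] M) (g : B →⋆ₐ[ℂ] M) (hc : ∀ a b, Commute (f a) (g b)) (a : A)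
    (b : B) : lift f g hc (ofTensor A B (a ⊗ₜ b)) = f a * g b :=
  (CStarSeminorm.universalLift_toCompletion _ _ _ _).trans
    (Algebra.TensorProduct.lift_tmul (f : A →ₐ[ℂ] M) (g : B →ₐ[ℂ] M) hc a b)

theorem lift_inl (f : A →⋆ₐ[ℂ] M) (g : B →⋆ₐ[ℂ] M) (hc : ∀ a b, Commute (f a) (g b)) (a : A) :
    lift f g hc (inl A B a) = f a := by
  refine (lift_ofTensor f g hc a 1).trans ?_
  rw [map_one, mul_one]

theorem lift_inr (f : A →⋆ₐ[ℂ] M) (g : B →⋆ₐ[ℂ] M) (hc : ∀ a b, Commute (f a) (g b)) (b : B) :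
    lift f g hc (inr A B b) = g b := by
  refine (lift_ofTensor f g hc 1 b).trans ?_
  rw [map_one, one_mul]

theorem starAlgHom_ext {f g : MaxTensorProduct A B →⋆ₐ[ℂ] M}
    (hl : ∀ a, f (inl A B a) = g (inl A B a)) (hr : ∀ b, f (inr A B b) = g (inr A B b)) :
    f = g := by
  refine CStarSeminorm.starAlgHom_ext _ fun x => ?_
  change f (ofTensor A B x) = g (ofTensor A B x)
  induction x with
  | zero => simp
  | add x y hx hy => rw [map_add, map_add, map_add, hx, hy]
  | tmul a b => rw [← inl_mul_inr, map_mul, map_mul, hl, hr]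

end MaxTensorProduct

/-- The images of X and its complement partition the image of R, which need not be R itself. -/
theorem IsSpectral.image_compl {R M : Type*} [Ring R] [Ring M] {C : InvariantSetAlgebra R}
    {e : Set R → M} (h : IsSpectral C e) (a : R) (b : R⁰) {X : Set R} (hX : X ∈ C.sets) :
    e ((fun x => a + b * x) '' Xᶜ) =
      e ((fun x => a + b * x) '' Set.univ) - e ((fun x => a + b * x) '' X) := by
  have h1 := h.union _ (C.affine_mem X hX a b b.2) _
    (C.affine_mem _ (C.isSetAlgebra.compl_mem hX) a b b.2)
    ((Set.disjoint_image_iff (affine_injective a b)).2 disjoint_compl_right)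
  rw [← Set.image_union, Set.union_compl_self] at h1
  rw [h1, add_sub_cancel_left]

/-! ### Products and restrictions of representations -/

namespace RingRepresentation

open InvariantSetAlgebra (rectangle_mem_prod)

section

variable {R₁ R₂ : Type*} [Ring R₁] [Ring R₂]
  {C₁ : InvariantSetAlgebra R₁} {C₂ : InvariantSetAlgebra R₂}

section Map

variable {R : Type*} [Ring R] {C : InvariantSetAlgebra R} {M N : Type*} [Ring M] [StarRing M]
  [Algebra ℂ M] [Ring N] [StarRing N] [Algebra ℂ N]

/-- The image of a representation under a *-homomorphism. -/
def map (ρ : RingRepresentation C M) (f : M →⋆ₐ[ℂ] N) : RingRepresentation C N where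
  e X := f (ρ.e X)
  u a := f (ρ.u a)
  s b := f (ρ.s b)
  spectral :=
    { univ := by rw [ρ.spectral.univ, map_one]
      inter := fun X hX Y hY => by rw [← map_mul, ρ.spectral.inter X hX Y hY]
      union := fun X hX Y hY hXY => by rw [ρ.spectral.union X hX Y hY hXY, map_add] }
  e_star X hX := by rw [← map_star, ρ.e_star X hX]
  u_star_mul a := by rw [← map_star, ← map_mul, ρ.u_star_mul, map_one]
  u_mul_star a := by rw [← map_star, ← map_mul, ρ.u_mul_star, map_one]
  s_star_mul b := by rw [← map_star, ← map_mul, ρ.s_star_mul, map_one]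
  u_zero := by rw [ρ.u_zero, map_one]
  affine_mul a c b d := by simp only [← map_mul, ρ.affine_mul]
  affine_e a b X hX := by simp only [← map_mul, ← map_star, ρ.affine_e a b X hX]

end Map

section Prod

variable {M₁ M₂ M : Type*} [Ring M₁] [StarRing M₁] [Algebra ℂ M₁] [Ring M₂] [StarRing M₂]
  [Algebra ℂ M₂] [Ring M] [StarRing M] [Algebra ℂ M]

/-- The representation of the product ring defined by representations of the factors in commuting
algebras. -/
def prod (ρ₁ : RingRepresentation C₁ M₁) (ρ₂ : RingRepresentation C₂ M₂) (f₁ : M₁ →⋆ₐ[ℂ] M)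
    (f₂ : M₂ →⋆ₐ[ℂ] M) (hc : ∀ x y, Commute (f₁ x) (f₂ y)) :
    RingRepresentation (C₁.prod C₂) M :=
  have hex : ∃ e : Set (R₁ × R₂) → M, IsSpectral (C₁.prod C₂) e ∧
      ∀ X ∈ C₁.sets, ∀ Y ∈ C₂.sets, e (X ×ˢ Y) = f₁ (ρ₁.e X) * f₂ (ρ₂.e Y) :=
    (ρ₁.map f₁).spectral.exists_prod (ρ₂.map f₂).spectral fun _ _ _ _ => hc _ _
  have hspec := hex.choose_spec.1
  have hrect := hex.choose_spec.2
  have hmul : ∀ x y x' y', f₁ x * f₂ y * (f₁ x' * f₂ y') = f₁ (x * x') * f₂ (y * y') :=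
    fun x y x' y' => by rw [(hc x' y).symm.mul_mul_mul_comm, map_mul, map_mul]
  have hstar : ∀ x y, star (f₁ x * f₂ y) = f₁ (star x) * f₂ (star y) := fun x y => by
    rw [star_mul, ← map_star, ← map_star, (hc _ _).eq]
  have hone : f₁ 1 * f₂ 1 = 1 := by rw [map_one, map_one, one_mul]
  -- With w the isometry u^a s_b of the product, the relation w e_X w* = e_(a+bX) holds on
  -- rectangles factor by factor and is then propagated to complements and intersections.
  have haff : ∀ a b, ∀ X ∈ (C₁.prod C₂).sets,
      f₁ (ρ₁.u a.1) * f₂ (ρ₂.u a.2) * (f₁ (ρ₁.s (regularFst b)) * f₂ (ρ₂.s (regularSnd b))) *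
        hex.choose X *
      star (f₁ (ρ₁.u a.1) * f₂ (ρ₂.u a.2) *
        (f₁ (ρ₁.s (regularFst b)) * f₂ (ρ₂.s (regularSnd b)))) =
      hex.choose ((fun x => a + b * x) '' X) := by
    intro a b X hX
    rw [hmul, hstar]
    have hr : ∀ A B (hA : A ∈ C₁.sets) (hB : B ∈ C₂.sets),
        f₁ (ρ₁.u a.1 * ρ₁.s (regularFst b)) * f₂ (ρ₂.u a.2 * ρ₂.s (regularSnd b)) *
          hex.choose (A ×ˢ B) * (f₁ (star (ρ₁.u a.1 * ρ₁.s (regularFst b))) *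
            f₂ (star (ρ₂.u a.2 * ρ₂.s (regularSnd b)))) =
          hex.choose ((fun x => a + b * x) '' (A ×ˢ B)) := by
      intro A B hA hB
      rw [affine_image_prod, hrect A hA B hB, hmul, hmul, ρ₁.affine_e _ _ A hA,
        ρ₂.affine_e _ _ B hB,
        hrect _ (C₁.affine_mem A hA a.1 (regularFst b) (regularFst b).2) _
          (C₂.affine_mem B hB a.2 (regularSnd b) (regularSnd b).2)]
    -- The range projection w w* is e of the image of the whole ring; it takes the place of 1 in the
    -- complement case.
    have hu := hr _ _ C₁.isSetAlgebra.univ_mem C₂.isSetAlgebra.univ_mem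
    rw [Set.univ_prod_univ, hspec.univ, mul_one] at hu
    have hi : f₁ (star (ρ₁.u a.1 * ρ₁.s (regularFst b))) *
        f₂ (star (ρ₂.u a.2 * ρ₂.s (regularSnd b))) *
        (f₁ (ρ₁.u a.1 * ρ₁.s (regularFst b)) * f₂ (ρ₂.u a.2 * ρ₂.s (regularSnd b))) = 1 := by
      rw [hmul, ρ₁.star_affine_mul, ρ₂.star_affine_mul, hone]
    induction hX using InvariantSetAlgebra.prod_induction with
    | rect A B hA hB => exact hr A B hA hB
    | compl X hX ih =>
      rw [hspec.image_compl a b hX, hspec.compl hX, mul_sub, sub_mul, mul_one, hu, ih]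
    | inter X Y hX hY ihX ihY =>
      rw [Set.image_inter (affine_injective a b),
        ← hspec.inter _ ((C₁.prod C₂).affine_mem X hX a b b.2) _
          ((C₁.prod C₂).affine_mem Y hY a b b.2), ← ihX, ← ihY, ← hspec.inter X hX Y hY]
      generalize f₁ (star (ρ₁.u a.1 * ρ₁.s (regularFst b))) *
        f₂ (star (ρ₂.u a.2 * ρ₂.s (regularSnd b))) = w' at hi ⊢
      generalize f₁ (ρ₁.u a.1 * ρ₁.s (regularFst b)) *
        f₂ (ρ₂.u a.2 * ρ₂.s (regularSnd b)) = w at hi ⊢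
      -- Inserting w* w = 1 between the factors shows that conjugation by w is multiplicative.
      calc w * (hex.choose X * hex.choose Y) * w'
          = w * hex.choose X * 1 * hex.choose Y * w' := by noncomm_ring
        _ = _ := by rw [← hi]; noncomm_ring
  { e := hex.choose
    u := fun a => f₁ (ρ₁.u a.1) * f₂ (ρ₂.u a.2)
    s := fun b => f₁ (ρ₁.s (regularFst b)) * f₂ (ρ₂.s (regularSnd b))
    spectral := hspec
    e_star := fun X hX => by
      induction hX using InvariantSetAlgebra.prod_induction with
      | rect A B hA hB => rw [hrect A hA B hB, hstar, ρ₁.e_star A hA, ρ₂.e_star B hB]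
      | compl X hX ih => rw [hspec.compl hX, star_sub, star_one, ih]
      | inter X Y hX hY ihX ihY =>
        rw [← hspec.inter X hX Y hY, star_mul, ihX, ihY, hspec.inter X hX Y hY,
          hspec.inter Y hY X hX, Set.inter_comm]
    u_star_mul := fun a => by rw [hstar, hmul, ρ₁.u_star_mul, ρ₂.u_star_mul, hone]
    u_mul_star := fun a => by rw [hstar, hmul, ρ₁.u_mul_star, ρ₂.u_mul_star, hone]
    s_star_mul := fun b => by rw [hstar, hmul, ρ₁.s_star_mul, ρ₂.s_star_mul, hone]
    u_zero := by rw [Prod.fst_zero, Prod.snd_zero, ρ₁.u_zero, ρ₂.u_zero, hone]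
    affine_mul := fun a c b d => by
      rw [hmul, hmul, hmul, hmul, ρ₁.affine_mul, ρ₂.affine_mul]
      rfl
    affine_e := haff }

theorem prod_e (ρ₁ : RingRepresentation C₁ M₁) (ρ₂ : RingRepresentation C₂ M₂) (f₁ : M₁ →⋆ₐ[ℂ] M)
    (f₂ : M₂ →⋆ₐ[ℂ] M) (hc : ∀ x y, Commute (f₁ x) (f₂ y)) {X : Set R₁} {Y : Set R₂}
    (hX : X ∈ C₁.sets) (hY : Y ∈ C₂.sets) :
    (ρ₁.prod ρ₂ f₁ f₂ hc).e (X ×ˢ Y) = f₁ (ρ₁.e X) * f₂ (ρ₂.e Y) :=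
  ((ρ₁.map f₁).spectral.exists_prod (ρ₂.map f₂).spectral fun _ _ _ _ => hc _ _).choose_spec.2
    X hX Y hY

end Prod

section Restrict

variable {M : Type*} [Ring M] [StarRing M] (ρ : RingRepresentation (C₁.prod C₂) M)

/-- The restriction of a representation for a product ring to the first factor. -/
def restrictLeft : RingRepresentation C₁ M where
  e X := ρ.e (X ×ˢ Set.univ)
  u a := ρ.u (a, 0)
  s b := ρ.s (regularPair b 1)
  spectral :=
    { univ := by rw [Set.univ_prod_univ, ρ.spectral.univ]
      inter := fun X hX Y hY => by
        rw [ρ.spectral.inter _ (rectangle_mem_prod hX C₂.isSetAlgebra.univ_mem) _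
          (rectangle_mem_prod hY C₂.isSetAlgebra.univ_mem), Set.prod_inter_prod,
          Set.univ_inter]
      union := fun X hX Y hY hXY => by
        rw [Set.union_prod, ρ.spectral.union _
          (rectangle_mem_prod hX C₂.isSetAlgebra.univ_mem) _
          (rectangle_mem_prod hY C₂.isSetAlgebra.univ_mem)
          (Set.disjoint_prod.2 (.inl hXY))] }
  e_star X hX := ρ.e_star _ (rectangle_mem_prod hX C₂.isSetAlgebra.univ_mem)
  u_star_mul a := ρ.u_star_mul _
  u_mul_star a := ρ.u_mul_star _
  s_star_mul b := ρ.s_star_mul _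
  u_zero := ρ.u_zero
  affine_mul a c b d := by
    rw [ρ.affine_mul, ← regularPair_mul, mul_one]
    congr 2
    exact Prod.ext rfl (by simp [regularPair])
  affine_e a b X hX := by
    rw [ρ.affine_e _ _ _ (rectangle_mem_prod hX C₂.isSetAlgebra.univ_mem),
      affine_image_prod]
    congr 2
    simp [regularSnd, regularPair]

/-- The restriction of a representation for a product ring to the second factor. -/
def restrictRight : RingRepresentation C₂ M where
  e Y := ρ.e (Set.univ ×ˢ Y)
  u a := ρ.u (0, a)
  s b := ρ.s (regularPair 1 b)
  spectral :=
    { univ := by rw [Set.univ_prod_univ, ρ.spectral.univ]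
      inter := fun X hX Y hY => by
        rw [ρ.spectral.inter _ (rectangle_mem_prod C₁.isSetAlgebra.univ_mem hX) _
          (rectangle_mem_prod C₁.isSetAlgebra.univ_mem hY), Set.prod_inter_prod,
          Set.univ_inter]
      union := fun X hX Y hY hXY => by
        rw [Set.prod_union, ρ.spectral.union _
          (rectangle_mem_prod C₁.isSetAlgebra.univ_mem hX) _
          (rectangle_mem_prod C₁.isSetAlgebra.univ_mem hY)
          (Set.disjoint_prod.2 (.inr hXY))] }
  e_star X hX := ρ.e_star _ (rectangle_mem_prod C₁.isSetAlgebra.univ_mem hX)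
  u_star_mul a := ρ.u_star_mul _
  u_mul_star a := ρ.u_mul_star _
  s_star_mul b := ρ.s_star_mul _
  u_zero := ρ.u_zero
  affine_mul a c b d := by
    rw [ρ.affine_mul, ← regularPair_mul, mul_one]
    congr 2
    exact Prod.ext (by simp [regularPair]) rfl
  affine_e a b X hX := by
    rw [ρ.affine_e _ _ _ (rectangle_mem_prod C₁.isSetAlgebra.univ_mem hX),
      affine_image_prod]
    congr 2
    simp [regularFst, regularPair]

theorem restrictLeft_e_mul_restrictRight_e {X : Set R₁} {Y : Set R₂} (hX : X ∈ C₁.sets)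
    (hY : Y ∈ C₂.sets) : ρ.restrictLeft.e X * ρ.restrictRight.e Y = ρ.e (X ×ˢ Y) := by
  refine (ρ.spectral.inter _ (rectangle_mem_prod hX C₂.isSetAlgebra.univ_mem) _
    (rectangle_mem_prod C₁.isSetAlgebra.univ_mem hY)).trans ?_
  rw [Set.prod_inter_prod, Set.inter_univ, Set.univ_inter]

theorem restrictLeft_u_mul_restrictRight_u (a : R₁ × R₂) :
    ρ.restrictLeft.u a.1 * ρ.restrictRight.u a.2 = ρ.u a := by
  refine (ρ.u_add (a.1, 0) (0, a.2)).symm.trans ?_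
  rw [Prod.fst_add_snd]

theorem restrictLeft_s_mul_restrictRight_s (b : (R₁ × R₂)⁰) :
    ρ.restrictLeft.s (regularFst b) * ρ.restrictRight.s (regularSnd b) = ρ.s b := by
  refine (ρ.s_mul (regularPair (regularFst b) 1) (regularPair 1 (regularSnd b))).symm.trans ?_
  rw [← regularPair_mul, mul_one, one_mul, regularPair_fst_snd]

theorem commute_restrict_e_e {X : Set R₁} {Y : Set R₂} (hX : X ∈ C₁.sets) (hY : Y ∈ C₂.sets) :
    Commute (ρ.restrictLeft.e X) (ρ.restrictRight.e Y) := by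
  rw [Commute, SemiconjBy, restrictLeft_e_mul_restrictRight_e ρ hX hY]
  refine .symm <| (ρ.spectral.inter _ (rectangle_mem_prod C₁.isSetAlgebra.univ_mem hY) _
    (rectangle_mem_prod hX C₂.isSetAlgebra.univ_mem)).trans ?_
  rw [Set.prod_inter_prod, Set.inter_univ, Set.univ_inter]

end Restrict

end

end RingRepresentation

/-! ### Commutation of the two restrictions -/

/-- Multiply on the right by w and cancel w* w. The hypothesis has the shape in which the action on
sets delivers the conjugate of a projection. -/
theorem commute_of_isometry {M : Type*} [Ring M] [StarRing M] {w e : M} (hw : star w * w = 1)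
    (h : w * e * star w = e * (w * star w)) : Commute w e := by
  have h1 := congrArg (· * w) h
  simp only [mul_assoc, hw, mul_one] at h1
  exact h1

/-- Write v* = v* (v v*), move w past the range projection and then past v. Commuting with v alone
would not suffice. -/
theorem commute_star_of_isometry {M : Type*} [Ring M] [StarRing M] {v w : M}
    (hv : star v * v = 1) (hc : Commute v w) (h : Commute (v * star v) w) :
    Commute (star v) w := by
  calc star v * w = star v * v * star v * w := by rw [hv, one_mul]
    _ = star v * (v * star v * w) := by simp only [mul_assoc]
    _ = star v * (w * (v * star v)) := by rw [h.eq]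
    _ = star v * (w * v) * star v := by simp only [mul_assoc]
    _ = star v * v * w * star v := by rw [← hc.eq, ← mul_assoc (star v)]
    _ = w * star v := by rw [hv, one_mul]

namespace RingRepresentation

open InvariantSetAlgebra (rectangle_mem_prod)

section

variable {R₁ R₂ : Type*} [Ring R₁] [Ring R₂]
  {C₁ : InvariantSetAlgebra R₁} {C₂ : InvariantSetAlgebra R₂}

section

variable {R : Type*} [Ring R] {C : InvariantSetAlgebra R} {M : Type*} [Ring M] [StarRing M]
  (ρ : RingRepresentation C M)

theorem affine_mul_star (a : R) (b : R⁰) :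
    ρ.u a * ρ.s b * star (ρ.u a * ρ.s b) = ρ.e ((fun x => a + b * x) '' Set.univ) := by
  rw [← ρ.affine_e a b _ C.isSetAlgebra.univ_mem, ρ.spectral.univ, mul_one]

theorem u_eq_affine (a : R) : ρ.u a = ρ.u a * ρ.s 1 := by rw [ρ.s_one, mul_one]

theorem s_eq_affine (b : R⁰) : ρ.s b = ρ.u 0 * ρ.s b := by rw [ρ.u_zero, one_mul]

end

section Restrict

variable {M : Type*} [Ring M] [StarRing M] (ρ : RingRepresentation (C₁.prod C₂) M)

/-- The first factor acts trivially on the second coordinate: w = u^a s_b conjugates e_(R₁×Y) to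
e_((a+bR₁)×Y), which is e_(R₁×Y) times the range projection of w. -/
theorem commute_restrictLeft_affine_e (a : R₁) (b : R₁⁰) {Y : Set R₂} (hY : Y ∈ C₂.sets) :
    Commute (ρ.restrictLeft.u a * ρ.restrictLeft.s b) (ρ.restrictRight.e Y) := by
  have hT := C₁.affine_mem _ C₁.isSetAlgebra.univ_mem a b b.2
  refine commute_of_isometry (ρ.restrictLeft.star_affine_mul a b) ?_
  rw [affine_mul_star, ← (ρ.commute_restrict_e_e hT hY).eq,
    restrictLeft_e_mul_restrictRight_e ρ hT hY]
  refine (ρ.affine_e (a, 0) (regularPair b 1) _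
    (rectangle_mem_prod C₁.isSetAlgebra.univ_mem hY)).trans ?_
  rw [affine_image_prod]
  congr 2
  simp [regularSnd, regularPair]

theorem commute_restrictRight_affine_e (a : R₂) (b : R₂⁰) {X : Set R₁} (hX : X ∈ C₁.sets) :
    Commute (ρ.restrictRight.u a * ρ.restrictRight.s b) (ρ.restrictLeft.e X) := by
  have hT := C₂.affine_mem _ C₂.isSetAlgebra.univ_mem a b b.2
  refine commute_of_isometry (ρ.restrictRight.star_affine_mul a b) ?_
  rw [affine_mul_star, restrictLeft_e_mul_restrictRight_e ρ hX hT]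
  refine (ρ.affine_e (0, a) (regularPair 1 b) _
    (rectangle_mem_prod hX C₂.isSetAlgebra.univ_mem)).trans ?_
  rw [affine_image_prod]
  congr 2
  simp [regularFst, regularPair]

/-- Affine maps in different coordinates commute, so both orders give the same element of the
ax+b-semigroup. -/
theorem commute_restrict_affine_affine (a : R₁) (b : R₁⁰) (c : R₂) (d : R₂⁰) :
    Commute (ρ.restrictLeft.u a * ρ.restrictLeft.s b)
      (ρ.restrictRight.u c * ρ.restrictRight.s d) := by
  refine (ρ.affine_mul (a, 0) (0, c) (regularPair b 1) (regularPair 1 d)).trans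
    (.trans ?_ (ρ.affine_mul (0, c) (a, 0) (regularPair 1 d) (regularPair b 1)).symm)
  rw [← regularPair_mul, ← regularPair_mul]
  simp [regularPair]

/-- The range projection on the left is the e of a set, and it already commutes with the affine
isometries on the right. -/
theorem commute_restrict_star_affine_affine (a : R₁) (b : R₁⁰) (c : R₂) (d : R₂⁰) :
    Commute (star (ρ.restrictLeft.u a * ρ.restrictLeft.s b))
      (ρ.restrictRight.u c * ρ.restrictRight.s d) := by
  refine commute_star_of_isometry (ρ.restrictLeft.star_affine_mul a b)
    (ρ.commute_restrict_affine_affine a b c d) ?_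
  rw [affine_mul_star]
  exact (ρ.commute_restrictRight_affine_e c d
    (C₁.affine_mem _ C₁.isSetAlgebra.univ_mem a b b.2)).symm

end Restrict

/-- An element that commutes with the canonical generators and their adjoints commutes with the
image of the full ring C*-algebra. -/
theorem commute_lift {R : Type*} [Ring R] {C : InvariantSetAlgebra R} {M : Type*} [CStarAlgebra M]
    (ρ : RingRepresentation C M) (y : M) (he : ∀ X ∈ C.sets, Commute (ρ.e X) y)
    (hw : ∀ a b, Commute (ρ.u a * ρ.s b) y) (hw' : ∀ a b, Commute (star (ρ.u a * ρ.s b)) y)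
    (x : FullRingCStarAlgebra C) : Commute (ρ.lift x) y := by
  -- The centralizer as a star subalgebra also requires commuting with y*; equivalently, z and z*
  -- both commute with y.
  have key : ∀ z, Commute z y → Commute (star z) y → z ∈ StarSubalgebra.centralizer ℂ {y} := by
    intro z h h'
    rw [StarSubalgebra.mem_centralizer_iff]
    rintro _ rfl
    exact ⟨h.symm, star_star z ▸ h'.star_star.symm⟩
  have hx : ρ.lift x ∈ StarSubalgebra.centralizer ℂ {y} := by
    refine starAlgHom_mem ρ.lift (Set.isClosed_centralizer _) (fun X hX => ?_) (fun a => ?_)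
      (fun b => ?_) x
    · rw [ρ.lift_e hX]
      exact key _ (he X hX) ((ρ.e_star X hX).symm ▸ he X hX)
    · rw [ρ.lift_u, u_eq_affine]
      exact key _ (hw a 1) (hw' a 1)
    · rw [ρ.lift_s, s_eq_affine]
      exact key _ (hw 0 b) (hw' 0 b)
  rw [StarSubalgebra.mem_centralizer_iff] at hx
  exact (hx y rfl).1.symm

/-- Two passes: x is arbitrary while the right-hand element is a generator, then x is fixed and y
arbitrary. -/
theorem commute_lift_restrict {M : Type*} [CStarAlgebra M]
    (ρ : RingRepresentation (C₁.prod C₂) M) (x : FullRingCStarAlgebra C₁)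
    (y : FullRingCStarAlgebra C₂) :
    Commute (ρ.restrictLeft.lift x) (ρ.restrictRight.lift y) := by
  have h : ∀ x, (∀ Y ∈ C₂.sets, Commute (ρ.restrictLeft.lift x) (ρ.restrictRight.e Y)) ∧
      ∀ c d, Commute (ρ.restrictLeft.lift x) (ρ.restrictRight.u c * ρ.restrictRight.s d) := by
    refine fun x => ⟨fun Y hY => ρ.restrictLeft.commute_lift _ ?_ ?_ ?_ x,
      fun c d => ρ.restrictLeft.commute_lift _ ?_ ?_ ?_ x⟩
    · exact fun X hX => ρ.commute_restrict_e_e hX hY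
    · exact fun a b => ρ.commute_restrictLeft_affine_e a b hY
    · intro a b
      have := (ρ.commute_restrictLeft_affine_e a b hY).star_star
      rwa [ρ.restrictRight.e_star Y hY] at this
    · exact fun X hX => (ρ.commute_restrictRight_affine_e c d hX).symm
    · exact fun a b => ρ.commute_restrict_affine_affine a b c d
    · exact fun a b => ρ.commute_restrict_star_affine_affine a b c d
  refine (ρ.restrictRight.commute_lift _ (fun Y hY => ((h x).1 Y hY).symm)
    (fun c d => ((h x).2 c d).symm) (fun c d => ?_) y).symm
  -- Adjoints of the right-hand generators are reached by taking adjoints in the statement for `star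
  -- x`.
  have := ((h (star x)).2 c d).star_star.symm
  rwa [map_star, star_star] at this

end

end RingRepresentation

/-! ### The isomorphism of the full algebras -/

section FullProduct

open RingRepresentation

variable {R₁ R₂ : Type*} [Ring R₁] [Ring R₂] (C₁ : InvariantSetAlgebra R₁)
  (C₂ : InvariantSetAlgebra R₂)

/-- The canonical *-homomorphism from the full ring C*-algebra of a product ring to the maximal
tensor product. -/
def fullProdToMax : FullRingCStarAlgebra (C₁.prod C₂) →⋆ₐ[ℂ]
    MaxTensorProduct (FullRingCStarAlgebra C₁) (FullRingCStarAlgebra C₂) :=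
  ((canonical C₁).prod (canonical C₂) (MaxTensorProduct.inl _ _) (MaxTensorProduct.inr _ _)
    MaxTensorProduct.commute_inl_inr).lift

/-- The canonical *-homomorphism from the maximal tensor product to the full ring C*-algebra of a
product ring. -/
def maxToFullProd : MaxTensorProduct (FullRingCStarAlgebra C₁) (FullRingCStarAlgebra C₂) →⋆ₐ[ℂ]
    FullRingCStarAlgebra (C₁.prod C₂) :=
  MaxTensorProduct.lift (canonical (C₁.prod C₂)).restrictLeft.lift
    (canonical (C₁.prod C₂)).restrictRight.lift (canonical (C₁.prod C₂)).commute_lift_restrict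

variable {C₁ C₂}

theorem fullProdToMax_e {X : Set R₁} {Y : Set R₂} (hX : X ∈ C₁.sets) (hY : Y ∈ C₂.sets) :
    fullProdToMax C₁ C₂ ((canonical (C₁.prod C₂)).e (X ×ˢ Y)) =
      MaxTensorProduct.inl _ _ ((canonical C₁).e X) *
        MaxTensorProduct.inr _ _ ((canonical C₂).e Y) :=
  (lift_e _ (InvariantSetAlgebra.rectangle_mem_prod hX hY)).trans (prod_e _ _ _ _ _ hX hY)

theorem fullProdToMax_u (a : R₁ × R₂) :
    fullProdToMax C₁ C₂ ((canonical (C₁.prod C₂)).u a) =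
      MaxTensorProduct.inl _ _ ((canonical C₁).u a.1) *
        MaxTensorProduct.inr _ _ ((canonical C₂).u a.2) := lift_u _ a

theorem fullProdToMax_s (b : (R₁ × R₂)⁰) :
    fullProdToMax C₁ C₂ ((canonical (C₁.prod C₂)).s b) =
      MaxTensorProduct.inl _ _ ((canonical C₁).s (regularFst b)) *
        MaxTensorProduct.inr _ _ ((canonical C₂).s (regularSnd b)) := lift_s _ b

theorem maxToFullProd_inl (x : FullRingCStarAlgebra C₁) :
    maxToFullProd C₁ C₂ (MaxTensorProduct.inl _ _ x) =
      (canonical (C₁.prod C₂)).restrictLeft.lift x := MaxTensorProduct.lift_inl _ _ _ x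

theorem maxToFullProd_inr (x : FullRingCStarAlgebra C₂) :
    maxToFullProd C₁ C₂ (MaxTensorProduct.inr _ _ x) =
      (canonical (C₁.prod C₂)).restrictRight.lift x := MaxTensorProduct.lift_inr _ _ _ x

theorem maxToFullProd_comp_fullProdToMax :
    (maxToFullProd C₁ C₂).comp (fullProdToMax C₁ C₂) = .id ℂ _ := by
  refine starAlgHom_ext (fun X hX => ?_) (fun a => ?_) (fun b => ?_)
  · have hspec := (canonical (C₁.prod C₂)).spectral
    change maxToFullProd C₁ C₂ (fullProdToMax C₁ C₂ _) = (canonical (C₁.prod C₂)).e X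
    induction hX using InvariantSetAlgebra.prod_induction with
    | rect A B hA hB =>
      rw [fullProdToMax_e hA hB, map_mul, maxToFullProd_inl, maxToFullProd_inr, lift_e _ hA,
        lift_e _ hB, restrictLeft_e_mul_restrictRight_e _ hA hB]
    | compl X hX ih =>
      rw [hspec.compl hX, map_sub, map_sub, map_one, map_one, ih]
    | inter X Y hX hY ihX ihY =>
      rw [← hspec.inter X hX Y hY, map_mul, map_mul, ihX, ihY]
  · change maxToFullProd C₁ C₂ (fullProdToMax C₁ C₂ _) = (canonical (C₁.prod C₂)).u a
    rw [fullProdToMax_u, map_mul, maxToFullProd_inl, maxToFullProd_inr, lift_u, lift_u,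
      restrictLeft_u_mul_restrictRight_u]
  · change maxToFullProd C₁ C₂ (fullProdToMax C₁ C₂ _) = (canonical (C₁.prod C₂)).s b
    rw [fullProdToMax_s, map_mul, maxToFullProd_inl, maxToFullProd_inr, lift_s, lift_s,
      restrictLeft_s_mul_restrictRight_s]

/-- Each factor is tested separately on its generators; the component in the other factor is e_R,
u^0 or s_1, each equal to 1. -/
theorem fullProdToMax_comp_maxToFullProd :
    (fullProdToMax C₁ C₂).comp (maxToFullProd C₁ C₂) = .id ℂ _ := by
  refine MaxTensorProduct.starAlgHom_ext (fun x => ?_) fun x => ?_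
  · have h : ((fullProdToMax C₁ C₂).comp (maxToFullProd C₁ C₂)).comp
        (MaxTensorProduct.inl _ _) = MaxTensorProduct.inl _ _ := by
      refine starAlgHom_ext (fun X hX => ?_) (fun a => ?_) (fun b => ?_) <;>
        refine (congrArg (fullProdToMax C₁ C₂) (maxToFullProd_inl _)).trans ?_
      · rw [lift_e _ hX]
        refine (fullProdToMax_e hX C₂.isSetAlgebra.univ_mem).trans ?_
        rw [(canonical C₂).spectral.univ, map_one, mul_one]
      · rw [lift_u]
        refine (fullProdToMax_u (a, 0)).trans ?_
        rw [(canonical C₂).u_zero, map_one, mul_one]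
      · rw [lift_s]
        refine (fullProdToMax_s (regularPair b 1)).trans ?_
        change _ * MaxTensorProduct.inr _ _ ((canonical C₂).s 1) = _
        rw [(canonical C₂).s_one, map_one, mul_one]
        rfl
    exact DFunLike.congr_fun h x
  · have h : ((fullProdToMax C₁ C₂).comp (maxToFullProd C₁ C₂)).comp
        (MaxTensorProduct.inr _ _) = MaxTensorProduct.inr _ _ := by
      refine starAlgHom_ext (fun X hX => ?_) (fun a => ?_) (fun b => ?_) <;>
        refine (congrArg (fullProdToMax C₁ C₂) (maxToFullProd_inr _)).trans ?_
      · rw [lift_e _ hX]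
        refine (fullProdToMax_e C₁.isSetAlgebra.univ_mem hX).trans ?_
        rw [(canonical C₁).spectral.univ, map_one, one_mul]
      · rw [lift_u]
        refine (fullProdToMax_u (0, a)).trans ?_
        rw [(canonical C₁).u_zero, map_one, one_mul]
      · rw [lift_s]
        refine (fullProdToMax_s (regularPair 1 b)).trans ?_
        change MaxTensorProduct.inl _ _ ((canonical C₁).s 1) * _ = _
        rw [(canonical C₁).s_one, map_one, one_mul]
        rfl
    exact DFunLike.congr_fun h x

variable (C₁ C₂) in
/-- The full ring C*-algebra of a product ring is the maximal tensor product of the full ring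
C*-algebras of the factors. -/
def fullProdEquiv : FullRingCStarAlgebra (C₁.prod C₂) ≃⋆ₐ[ℂ]
    MaxTensorProduct (FullRingCStarAlgebra C₁) (FullRingCStarAlgebra C₂) :=
  .ofStarAlgHom (fullProdToMax C₁ C₂) (maxToFullProd C₁ C₂) maxToFullProd_comp_fullProdToMax
    fullProdToMax_comp_maxToFullProd

end FullProduct

/-! ### Hilbert space tensor products -/

section HilbertTensor

variable {H K : Type*} [NormedAddCommGroup H] [InnerProductSpace ℂ H]
  [NormedAddCommGroup K] [InnerProductSpace ℂ K]

theorem hilbertTensor_induction {P : HilbertTensor H K → Prop} (hP : IsClosed {z | P z})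
    (tmul : ∀ x y, P (hilbertTmul x y)) (add : ∀ z w, P z → P w → P (z + w))
    (z : HilbertTensor H K) : P z := by
  refine UniformSpace.Completion.induction_on (α := H ⊗[ℂ] K) z hP fun t => ?_
  induction t with
  | zero =>
    have h := tmul 0 0
    rwa [hilbertTmul, TensorProduct.zero_tmul] at h
  | tmul x y => exact tmul x y
  | add t s ht hs =>
    have h := add _ _ ht hs
    exact (congrArg P (UniformSpace.Completion.coe_add t s)).mpr h

theorem hilbertTensor_ext {L : Type*} [NormedAddCommGroup L] [NormedSpace ℂ L]
    {S T : HilbertTensor H K →L[ℂ] L}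
    (h : ∀ x y, S (hilbertTmul x y) = T (hilbertTmul x y)) : S = T :=
  ContinuousLinearMap.ext <| hilbertTensor_induction (isClosed_eq S.continuous T.continuous) h
    fun z w hz hw => by rw [map_add, map_add, hz, hw]

theorem hilbertTmul_add_left (x x' : H) (y : K) :
    hilbertTmul (x + x') y = hilbertTmul x y + hilbertTmul x' y := by
  rw [hilbertTmul, TensorProduct.add_tmul]
  exact UniformSpace.Completion.coe_add _ _

theorem hilbertTmul_add_right (x : H) (y y' : K) :
    hilbertTmul x (y + y') = hilbertTmul x y + hilbertTmul x y' := by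
  rw [hilbertTmul, TensorProduct.tmul_add]
  exact UniformSpace.Completion.coe_add _ _

theorem hilbertTmul_smul_left (c : ℂ) (x : H) (y : K) :
    hilbertTmul (c • x) y = c • hilbertTmul x y := by
  rw [hilbertTmul, ← TensorProduct.smul_tmul']
  exact UniformSpace.Completion.coe_smul c _

theorem hilbertTmul_smul_right (c : ℂ) (x : H) (y : K) :
    hilbertTmul x (c • y) = c • hilbertTmul x y := by
  rw [hilbertTmul, TensorProduct.tmul_smul]
  exact UniformSpace.Completion.coe_smul c _

theorem norm_hilbertTmul (x : H) (y : K) : ‖hilbertTmul x y‖ = ‖x‖ * ‖y‖ := by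
  rw [← sq_eq_sq₀ (norm_nonneg _) (by positivity), mul_pow]
  have h := inner_hilbertTmul x x y y
  rw [inner_self_eq_norm_sq_to_K, inner_self_eq_norm_sq_to_K, inner_self_eq_norm_sq_to_K] at h
  exact_mod_cast h

/-- The bounded operator `x ↦ x ⊗ y`. -/
def hilbertTmulLeft (y : K) : H →L[ℂ] HilbertTensor H K :=
  LinearMap.mkContinuous
    { toFun := fun x => hilbertTmul x y
      map_add' := fun x x' => hilbertTmul_add_left x x' y
      map_smul' := fun c x => hilbertTmul_smul_left c x y } ‖y‖
    fun x => (norm_hilbertTmul x y).le.trans (mul_comm _ _).le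

/-- The bounded operator `y ↦ x ⊗ y`. -/
def hilbertTmulRight (x : H) : K →L[ℂ] HilbertTensor H K :=
  LinearMap.mkContinuous
    { toFun := fun y => hilbertTmul x y
      map_add' := fun y y' => hilbertTmul_add_right x y y'
      map_smul' := fun c y => hilbertTmul_smul_right c x y } ‖x‖
    fun y => (norm_hilbertTmul x y).le

theorem tensorOperator_mul (S S' : H →L[ℂ] H) (T T' : K →L[ℂ] K) :
    tensorOperator S T * tensorOperator S' T' = tensorOperator (S * S') (T * T') :=
  hilbertTensor_ext fun x y => by
    rw [mul_apply_eq_comp, tensorOperator_tmul, tensorOperator_tmul,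
      tensorOperator_tmul]
    rfl

theorem tensorOperator_one : tensorOperator (1 : H →L[ℂ] H) (1 : K →L[ℂ] K) = 1 :=
  hilbertTensor_ext fun x y => tensorOperator_tmul _ _ x y

variable [CompleteSpace H] [CompleteSpace K]

/-- The adjoint identity is continuous and additive in each vector, so elementary tensors suffice in
both. -/
theorem star_tensorOperator (S : H →L[ℂ] H) (T : K →L[ℂ] K) :
    star (tensorOperator S T) = tensorOperator (star S) (star T) := by
  refine ((ContinuousLinearMap.eq_adjoint_iff _ _).2 fun z w => ?_).symm
  refine hilbertTensor_induction (P := fun z =>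
    inner ℂ (tensorOperator (star S) (star T) z) w = inner ℂ z (tensorOperator S T w))
    (isClosed_eq (by fun_prop) (by fun_prop)) (fun x y => ?_) (fun z z' hz hz' => ?_) z
  · refine hilbertTensor_induction (P := fun w =>
      inner ℂ (tensorOperator (star S) (star T) (hilbertTmul x y)) w =
        inner ℂ (hilbertTmul x y) (tensorOperator S T w))
      (isClosed_eq (by fun_prop) (by fun_prop)) (fun x' y' => ?_) (fun w w' hw hw' => ?_) w
    · rw [tensorOperator_tmul, tensorOperator_tmul, inner_hilbertTmul, inner_hilbertTmul,
        ContinuousLinearMap.star_eq_adjoint, ContinuousLinearMap.star_eq_adjoint,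
        ContinuousLinearMap.adjoint_inner_left, ContinuousLinearMap.adjoint_inner_left]
    · rw [inner_add_right, hw, hw', map_add, inner_add_right]
  · rw [map_add, inner_add_left, hz, hz', inner_add_left]

variable (H K) in
/-- The amplification `S ↦ S ⊗ 1`. -/
def leftAmplification : (H →L[ℂ] H) →⋆ₐ[ℂ] (HilbertTensor H K →L[ℂ] HilbertTensor H K) where
  toFun S := tensorOperator S 1
  map_one' := tensorOperator_one
  map_mul' S S' := by rw [tensorOperator_mul, mul_one]
  map_zero' := hilbertTensor_ext fun x y =>
    (tensorOperator_tmul _ _ x y).trans (map_zero (hilbertTmulLeft (H := H) y))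
  map_add' S S' := hilbertTensor_ext fun x y => by
    rw [add_apply, tensorOperator_tmul, tensorOperator_tmul,
      tensorOperator_tmul]
    exact hilbertTmul_add_left _ _ _
  commutes' c := hilbertTensor_ext fun x y => by
    rw [tensorOperator_tmul]
    exact hilbertTmul_smul_left _ _ _
  map_star' S := by rw [star_tensorOperator, star_one]

variable (H K) in
/-- The amplification `T ↦ 1 ⊗ T`. -/
def rightAmplification : (K →L[ℂ] K) →⋆ₐ[ℂ] (HilbertTensor H K →L[ℂ] HilbertTensor H K) where
  toFun T := tensorOperator 1 T
  map_one' := tensorOperator_one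
  map_mul' S S' := by rw [tensorOperator_mul, mul_one]
  map_zero' := hilbertTensor_ext fun x y =>
    (tensorOperator_tmul _ _ x y).trans (map_zero (hilbertTmulRight (K := K) x))
  map_add' S S' := hilbertTensor_ext fun x y => by
    rw [add_apply, tensorOperator_tmul, tensorOperator_tmul,
      tensorOperator_tmul]
    exact hilbertTmul_add_right _ _ _
  commutes' c := hilbertTensor_ext fun x y => by
    rw [tensorOperator_tmul]
    exact hilbertTmul_smul_right _ _ _
  map_star' S := by rw [star_tensorOperator, star_one]

end HilbertTensor

/-! ### The Hilbert space of a product -/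

section EllTwo

theorem topologicalClosure_span_ellTwoBasis (R : Type*) :
    (Submodule.span ℂ (Set.range (ellTwoBasis : R → EllTwo R))).topologicalClosure = ⊤ := by
  classical
  -- The identity of ℓ²(R), taken as coordinate map, is a Hilbert basis with the vectors
  -- `ellTwoBasis`.
  have h := (HilbertBasis.ofRepr (LinearIsometryEquiv.refl ℂ (EllTwo R))).dense_span
  have hb : ⇑(HilbertBasis.ofRepr (LinearIsometryEquiv.refl ℂ (EllTwo R))) = ellTwoBasis := by
    ext1 r
    rw [← HilbertBasis.repr_symm_single]
    unfold ellTwoBasis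
    congr!
  rwa [hb] at h

theorem ellTwo_ext {R L : Type*} [NormedAddCommGroup L] [NormedSpace ℂ L]
    {S T : EllTwo R →L[ℂ] L} (h : ∀ r, S (ellTwoBasis r) = T (ellTwoBasis r)) : S = T :=
  ContinuousLinearMap.ext_on
    (Submodule.dense_iff_topologicalClosure_eq_top.2 (topologicalClosure_span_ellTwoBasis R))
    (by rintro _ ⟨r, rfl⟩; exact h r)

theorem indicatorOperator_basis {R : Type*} (X : Set R) (r : R) [Decidable (r ∈ X)] :
    indicatorOperator X (ellTwoBasis r) = if r ∈ X then ellTwoBasis r else 0 := by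
  classical
  ext s
  rw [indicatorOperator_apply]
  by_cases hs : s = r
  · subst hs
    split_ifs with h
    · rw [Set.indicator_of_mem h]
    · rw [Set.indicator_of_notMem h]; rfl
  · have h0 : (ellTwoBasis r : EllTwo R) s = 0 := by
      simp [ellTwoBasis, lp.single_apply, hs]
    have h1 : X.indicator (ellTwoBasis r : EllTwo R) s = 0 := by
      rw [Set.indicator_apply, h0, ite_self]
    rw [h1]
    split_ifs
    · exact h0.symm
    · rfl

theorem indicatorOperator_univ {R : Type*} : indicatorOperator (Set.univ : Set R) = 1 := by
  classical
  exact ellTwo_ext fun r => by simp [indicatorOperator_basis]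

theorem indicatorOperator_compl {R : Type*} (X : Set R) :
    indicatorOperator Xᶜ = 1 - indicatorOperator X := by
  classical
  refine ellTwo_ext fun r => ?_
  rw [sub_apply, indicatorOperator_basis, indicatorOperator_basis]
  by_cases h : r ∈ X <;> simp [h]

theorem indicatorOperator_inter {R : Type*} (X Y : Set R) :
    indicatorOperator (X ∩ Y) = indicatorOperator X * indicatorOperator Y := by
  classical
  refine ellTwo_ext fun r => ?_
  rw [mul_apply_eq_comp, indicatorOperator_basis, indicatorOperator_basis]
  by_cases h : r ∈ Y <;> simp [h, indicatorOperator_basis]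

variable (R₁ R₂ : Type*)

theorem orthonormal_hilbertTmul_ellTwoBasis :
    Orthonormal ℂ fun r : R₁ × R₂ =>
      hilbertTmul (ellTwoBasis r.1 : EllTwo R₁) (ellTwoBasis r.2 : EllTwo R₂) := by
  classical
  rw [orthonormal_iff_ite]
  rintro ⟨i, j⟩ ⟨i', j'⟩
  rw [inner_hilbertTmul, orthonormal_iff_ite.1 orthonormal_ellTwoBasis,
    orthonormal_iff_ite.1 orthonormal_ellTwoBasis]
  by_cases h : i = i' <;> by_cases h' : j = j' <;> simp [h, h']

/-- Density in one variable at a time: the closed span contains all x ⊗ ξ_s, hence all x ⊗ y, hence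
everything. -/
theorem topologicalClosure_span_hilbertTmul_ellTwoBasis :
    ⊤ ≤ (Submodule.span ℂ (Set.range fun r : R₁ × R₂ =>
      hilbertTmul (ellTwoBasis r.1 : EllTwo R₁) (ellTwoBasis r.2 : EllTwo R₂))).topologicalClosure
    := by
  set W := (Submodule.span ℂ (Set.range fun r : R₁ × R₂ =>
    hilbertTmul (ellTwoBasis r.1 : EllTwo R₁) (ellTwoBasis r.2 : EllTwo R₂))).topologicalClosure
    with hW
  have hc : IsClosed (W : Set (HilbertTensor (EllTwo R₁) (EllTwo R₂))) :=
    Submodule.isClosed_topologicalClosure _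
  have h1 : ∀ x s, hilbertTmul (x : EllTwo R₁) (ellTwoBasis s : EllTwo R₂) ∈ W := by
    intro x s
    have h : (Submodule.span ℂ (Set.range (ellTwoBasis : R₁ → EllTwo R₁))).topologicalClosure ≤
        W.comap (hilbertTmulLeft (H := EllTwo R₁) (ellTwoBasis s : EllTwo R₂)).toLinearMap := by
      refine Submodule.topologicalClosure_minimal _ (Submodule.span_le.2 ?_)
        (hc.preimage (hilbertTmulLeft (H := EllTwo R₁) (ellTwoBasis s : EllTwo R₂)).continuous)
      rintro _ ⟨r, rfl⟩
      exact Submodule.le_topologicalClosure _ (Submodule.subset_span ⟨(r, s), rfl⟩)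
    exact h (topologicalClosure_span_ellTwoBasis R₁ ▸ Submodule.mem_top)
  have h2 : ∀ x y, hilbertTmul (x : EllTwo R₁) (y : EllTwo R₂) ∈ W := by
    intro x y
    have h : (Submodule.span ℂ (Set.range (ellTwoBasis : R₂ → EllTwo R₂))).topologicalClosure ≤
        W.comap (hilbertTmulRight (K := EllTwo R₂) x).toLinearMap := by
      refine Submodule.topologicalClosure_minimal _ (Submodule.span_le.2 ?_)
        (hc.preimage (hilbertTmulRight (K := EllTwo R₂) x).continuous)
      rintro _ ⟨r, rfl⟩
      exact h1 x r
    exact h (topologicalClosure_span_ellTwoBasis R₂ ▸ Submodule.mem_top)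
  exact fun z _ => hilbertTensor_induction (P := fun z => z ∈ W) hc h2
    (fun z w hz hw => add_mem hz hw) z

/-- The unitary from `ℓ²(R₁ × R₂)` to `ℓ²(R₁) ⊗ ℓ²(R₂)`. -/
def ellTwoProd : EllTwo (R₁ × R₂) ≃ₗᵢ[ℂ] HilbertTensor (EllTwo R₁) (EllTwo R₂) :=
  (HilbertBasis.mk (orthonormal_hilbertTmul_ellTwoBasis R₁ R₂)
    (topologicalClosure_span_hilbertTmul_ellTwoBasis R₁ R₂)).repr.symm

variable {R₁ R₂}

theorem ellTwoProd_basis (r : R₁ × R₂) :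
    ellTwoProd R₁ R₂ (ellTwoBasis r) = hilbertTmul (ellTwoBasis r.1) (ellTwoBasis r.2) := by
  classical
  refine Eq.trans ?_ (congrFun (HilbertBasis.coe_mk (orthonormal_hilbertTmul_ellTwoBasis R₁ R₂)
    (topologicalClosure_span_hilbertTmul_ellTwoBasis R₁ R₂)) r)
  rw [← HilbertBasis.repr_symm_single]
  rw [ellTwoProd, ellTwoBasis]
  congr!

variable (R₁ R₂) in
/-- Conjugation by the unitary from `ℓ²(R₁ × R₂)` to `ℓ²(R₁) ⊗ ℓ²(R₂)`. -/
def conjEllTwoProd : (EllTwo (R₁ × R₂) →L[ℂ] EllTwo (R₁ × R₂)) ≃⋆ₐ[ℂ]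
    (HilbertTensor (EllTwo R₁) (EllTwo R₂) →L[ℂ] HilbertTensor (EllTwo R₁) (EllTwo R₂)) :=
  (ellTwoProd R₁ R₂).conjStarAlgEquiv

/-- The hypothesis says that the unitary intertwines A and S ⊗ T on the basis, hence everywhere by
continuity. -/
theorem conjEllTwoProd_eq {A : EllTwo (R₁ × R₂) →L[ℂ] EllTwo (R₁ × R₂)}
    {S : EllTwo R₁ →L[ℂ] EllTwo R₁} {T : EllTwo R₂ →L[ℂ] EllTwo R₂}
    (h : ∀ r : R₁ × R₂, ellTwoProd R₁ R₂ (A (ellTwoBasis r)) =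
      hilbertTmul (S (ellTwoBasis r.1)) (T (ellTwoBasis r.2))) :
    conjEllTwoProd R₁ R₂ A = tensorOperator S T := by
  have h1 : ((ellTwoProd R₁ R₂ : EllTwo (R₁ × R₂) →L[ℂ] _).comp A) =
      (tensorOperator S T).comp (ellTwoProd R₁ R₂ : EllTwo (R₁ × R₂) →L[ℂ] _) := by
    refine ellTwo_ext fun r => (h r).trans ?_
    refine Eq.trans ?_ (congrArg (tensorOperator S T) (ellTwoProd_basis r)).symm
    rw [tensorOperator_tmul]
  ext1 z
  have h2 := DFunLike.congr_fun h1 ((ellTwoProd R₁ R₂).symm z)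
  refine (LinearIsometryEquiv.conjStarAlgEquiv_apply_apply _ _ _).trans (h2.trans ?_)
  exact congrArg (tensorOperator S T) ((ellTwoProd R₁ R₂).apply_symm_apply z)

theorem conjEllTwoProd_indicatorOperator (X : Set R₁) (Y : Set R₂) :
    conjEllTwoProd R₁ R₂ (indicatorOperator (X ×ˢ Y)) =
      tensorOperator (indicatorOperator X) (indicatorOperator Y) := by
  classical
  refine conjEllTwoProd_eq fun r => ?_
  rw [indicatorOperator_basis, indicatorOperator_basis, indicatorOperator_basis]
  have hl : ∀ y : EllTwo R₂, hilbertTmul (0 : EllTwo R₁) y = 0 := fun y =>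
    map_zero (hilbertTmulLeft (H := EllTwo R₁) y)
  have hr : ∀ x : EllTwo R₁, hilbertTmul x (0 : EllTwo R₂) = 0 := fun x =>
    map_zero (hilbertTmulRight (K := EllTwo R₂) x)
  by_cases h : r.1 ∈ X <;> by_cases h' : r.2 ∈ Y <;>
    simp [h, h', hl, hr, ellTwoProd_basis, Set.mem_prod]

theorem conjEllTwoProd_injectionOperator {f : R₁ × R₂ → R₁ × R₂} (hf : Function.Injective f)
    {f₁ : R₁ → R₁} (hf₁ : Function.Injective f₁) {f₂ : R₂ → R₂} (hf₂ : Function.Injective f₂)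
    (h : ∀ r, f r = (f₁ r.1, f₂ r.2)) :
    conjEllTwoProd R₁ R₂ (injectionOperator f hf) =
      tensorOperator (injectionOperator f₁ hf₁) (injectionOperator f₂ hf₂) :=
  conjEllTwoProd_eq fun r => by
    rw [injectionOperator_basis, injectionOperator_basis, injectionOperator_basis,
      ellTwoProd_basis, h]

end EllTwo

/-! ### The reduced ring C*-algebra of a product -/

theorem StarSubalgebra.equiv_of_mem {A B : Type*} [Ring A] [StarRing A] [Algebra ℂ A]
    [StarModule ℂ A] [Ring B] [StarRing B] [Algebra ℂ B] [StarModule ℂ B] (Φ : A ≃⋆ₐ[ℂ] B)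
    (S : StarSubalgebra ℂ A) (T : StarSubalgebra ℂ B) (h : ∀ x ∈ S, Φ x ∈ T)
    (h' : ∀ y ∈ T, Φ.symm y ∈ S) : Nonempty (S ≃⋆ₐ[ℂ] T) :=
  ⟨.ofStarAlgHom
    ((Φ.toStarAlgHom.comp S.subtype).codRestrict T fun x => h x x.2)
    ((Φ.symm.toStarAlgHom.comp T.subtype).codRestrict S fun x => h' x x.2)
    (StarAlgHom.ext fun x => Subtype.ext (Φ.symm_apply_apply x))
    (StarAlgHom.ext fun x => Subtype.ext (Φ.apply_symm_apply x))⟩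

section Reduced

theorem translationOperator_zero {R : Type*} [Ring R] :
    translationOperator (0 : R) = 1 :=
  ellTwo_ext fun r => (injectionOperator_basis _ _ r).trans (by rw [zero_add]; rfl)

theorem multiplicationOperator_one {R : Type*} [Ring R] :
    multiplicationOperator (1 : R⁰) = 1 :=
  ellTwo_ext fun r => (injectionOperator_basis _ _ r).trans (by
    change ellTwoBasis ((1 : R) * r) = _; rw [one_mul]; rfl)

variable {R₁ R₂ : Type*} [Ring R₁] [Ring R₂]

theorem conjEllTwoProd_translationOperator (a : R₁ × R₂) :
    conjEllTwoProd R₁ R₂ (translationOperator a) =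
      tensorOperator (translationOperator a.1) (translationOperator a.2) :=
  conjEllTwoProd_injectionOperator _ _ _ fun _ => rfl

theorem conjEllTwoProd_multiplicationOperator (b : (R₁ × R₂)⁰) :
    conjEllTwoProd R₁ R₂ (multiplicationOperator b) =
      tensorOperator (multiplicationOperator (regularFst b))
        (multiplicationOperator (regularSnd b)) :=
  conjEllTwoProd_injectionOperator _ _ _ fun _ => rfl

section

variable {R : Type*} [Ring R] {C : InvariantSetAlgebra R}

theorem indicatorOperator_mem {X : Set R} (hX : X ∈ C.sets) :
    indicatorOperator X ∈ reducedRingCStarAlgebra C :=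
  StarSubalgebra.le_topologicalClosure _
    (StarAlgebra.subset_adjoin _ _ (.inl (.inl ⟨X, hX, rfl⟩)))

theorem translationOperator_mem (a : R) : translationOperator a ∈ reducedRingCStarAlgebra C :=
  StarSubalgebra.le_topologicalClosure _ (StarAlgebra.subset_adjoin _ _ (.inl (.inr ⟨a, rfl⟩)))

theorem multiplicationOperator_mem (b : R⁰) :
    multiplicationOperator b ∈ reducedRingCStarAlgebra C :=
  StarSubalgebra.le_topologicalClosure _ (StarAlgebra.subset_adjoin _ _ (.inr ⟨b, rfl⟩))

/-- A *-homomorphism maps the reduced ring C*-algebra to a closed star subalgebra if it maps the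
generators there. -/
theorem map_mem_of_mem_reducedRingCStarAlgebra {M : Type*} [CStarAlgebra M]
    (f : (EllTwo R →L[ℂ] EllTwo R) →⋆ₐ[ℂ] M) {T : StarSubalgebra ℂ M} (hT : IsClosed (T : Set M))
    (he : ∀ X ∈ C.sets, f (indicatorOperator X) ∈ T) (hu : ∀ a, f (translationOperator a) ∈ T)
    (hs : ∀ b, f (multiplicationOperator b) ∈ T) {x : EllTwo R →L[ℂ] EllTwo R}
    (hx : x ∈ reducedRingCStarAlgebra C) : f x ∈ T := by
  have h : reducedRingCStarAlgebra C ≤ T.comap f := by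
    refine StarSubalgebra.topologicalClosure_minimal (StarAlgebra.adjoin_le ?_)
      (hT.preimage f.continuous_of_cstarAlgebra)
    rintro _ ((⟨X, hX, rfl⟩ | ⟨a, rfl⟩) | ⟨b, rfl⟩)
    · exact he X hX
    · exact hu a
    · exact hs b
  exact h hx

end

theorem tensorOperator_mem_minTensorProduct {H K : Type*} [NormedAddCommGroup H]
    [InnerProductSpace ℂ H] [NormedAddCommGroup K] [InnerProductSpace ℂ K] [CompleteSpace H]
    [CompleteSpace K] {A : StarSubalgebra ℂ (H →L[ℂ] H)} {B : StarSubalgebra ℂ (K →L[ℂ] K)}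
    {S : H →L[ℂ] H} {T : K →L[ℂ] K} (hS : S ∈ A) (hT : T ∈ B) :
    tensorOperator S T ∈ minTensorProduct A B :=
  StarSubalgebra.le_topologicalClosure _
    (StarAlgebra.subset_adjoin _ _ ⟨S, hS, T, hT, rfl⟩)

/-- The reduced ring C*-algebra of a product ring is the minimal tensor product of the reduced ring
C*-algebras of the factors. -/
theorem nonempty_reducedProdEquiv (C₁ : InvariantSetAlgebra R₁) (C₂ : InvariantSetAlgebra R₂) :
    Nonempty (reducedRingCStarAlgebra (C₁.prod C₂) ≃⋆ₐ[ℂ]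
      minTensorProduct (reducedRingCStarAlgebra C₁) (reducedRingCStarAlgebra C₂)) := by
  refine StarSubalgebra.equiv_of_mem (conjEllTwoProd R₁ R₂) _ _ (fun x hx => ?_) fun y hy => ?_
  · refine map_mem_of_mem_reducedRingCStarAlgebra (conjEllTwoProd R₁ R₂).toStarAlgHom
      (StarSubalgebra.isClosed_topologicalClosure _) (fun X hX => ?_) (fun a => ?_) (fun b => ?_) hx
    · change conjEllTwoProd R₁ R₂ _ ∈ _
      induction hX using InvariantSetAlgebra.prod_induction with
      | rect A B hA hB =>
        rw [conjEllTwoProd_indicatorOperator]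
        exact tensorOperator_mem_minTensorProduct (indicatorOperator_mem hA)
          (indicatorOperator_mem hB)
      | compl X hX ih =>
        rw [indicatorOperator_compl, map_sub, map_one]
        exact sub_mem (one_mem _) ih
      | inter X Y hX hY ihX ihY =>
        rw [indicatorOperator_inter, map_mul]
        exact mul_mem ihX ihY
    · change conjEllTwoProd R₁ R₂ _ ∈ _
      rw [conjEllTwoProd_translationOperator]
      exact tensorOperator_mem_minTensorProduct (translationOperator_mem _)
        (translationOperator_mem _)
    · change conjEllTwoProd R₁ R₂ _ ∈ _
      rw [conjEllTwoProd_multiplicationOperator]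
      exact tensorOperator_mem_minTensorProduct (multiplicationOperator_mem _)
        (multiplicationOperator_mem _)
  · have hcl : IsClosed (reducedRingCStarAlgebra (C₁.prod C₂) :
        Set (EllTwo (R₁ × R₂) →L[ℂ] EllTwo (R₁ × R₂))) :=
      StarSubalgebra.isClosed_topologicalClosure _
    have key : ∀ {A S T}, conjEllTwoProd R₁ R₂ A = tensorOperator S T →
        A ∈ reducedRingCStarAlgebra (C₁.prod C₂) →
        (conjEllTwoProd R₁ R₂).symm (tensorOperator S T) ∈
          reducedRingCStarAlgebra (C₁.prod C₂) := fun h hA => by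
      rwa [← h, StarAlgEquiv.symm_apply_apply]
    -- S ↦ S ⊗ 1 is a *-homomorphism, so generators suffice: E_X ⊗ 1, U^a ⊗ 1 and S_b ⊗ 1 correspond
    -- to E_(X×R₂), U^(a,0) and S_(b,1).
    have hl : ∀ S ∈ reducedRingCStarAlgebra C₁,
        (conjEllTwoProd R₁ R₂).symm (tensorOperator S 1) ∈
          reducedRingCStarAlgebra (C₁.prod C₂) := by
      intro S hS
      refine map_mem_of_mem_reducedRingCStarAlgebra
        ((conjEllTwoProd R₁ R₂).symm.toStarAlgHom.comp
          (leftAmplification (EllTwo R₁) (EllTwo R₂))) hcl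
        (fun X hX => ?_) (fun a => ?_) (fun b => ?_) hS
      · refine key (A := indicatorOperator (X ×ˢ Set.univ)) ?_ (indicatorOperator_mem
          (InvariantSetAlgebra.rectangle_mem_prod hX C₂.isSetAlgebra.univ_mem))
        rw [conjEllTwoProd_indicatorOperator, indicatorOperator_univ]
      · refine key (A := translationOperator (a, 0)) ?_ (translationOperator_mem _)
        rw [conjEllTwoProd_translationOperator, translationOperator_zero]
      · refine key (A := multiplicationOperator (regularPair b 1)) ?_
          (multiplicationOperator_mem _)
        refine (conjEllTwoProd_multiplicationOperator _).trans ?_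
        exact congrArg (tensorOperator _) multiplicationOperator_one
    have hr : ∀ T ∈ reducedRingCStarAlgebra C₂,
        (conjEllTwoProd R₁ R₂).symm (tensorOperator 1 T) ∈
          reducedRingCStarAlgebra (C₁.prod C₂) := by
      intro T hT
      refine map_mem_of_mem_reducedRingCStarAlgebra
        ((conjEllTwoProd R₁ R₂).symm.toStarAlgHom.comp
          (rightAmplification (EllTwo R₁) (EllTwo R₂))) hcl
        (fun X hX => ?_) (fun a => ?_) (fun b => ?_) hT
      · refine key (A := indicatorOperator (Set.univ ×ˢ X)) ?_ (indicatorOperator_mem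
          (InvariantSetAlgebra.rectangle_mem_prod C₁.isSetAlgebra.univ_mem hX))
        rw [conjEllTwoProd_indicatorOperator, indicatorOperator_univ]
      · refine key (A := translationOperator (0, a)) ?_ (translationOperator_mem _)
        rw [conjEllTwoProd_translationOperator, translationOperator_zero]
      · refine key (A := multiplicationOperator (regularPair 1 b)) ?_
          (multiplicationOperator_mem _)
        refine (conjEllTwoProd_multiplicationOperator _).trans ?_
        exact congrArg (tensorOperator · _) multiplicationOperator_one
    have h : minTensorProduct (reducedRingCStarAlgebra C₁) (reducedRingCStarAlgebra C₂) ≤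
        (reducedRingCStarAlgebra (C₁.prod C₂)).comap
          (conjEllTwoProd R₁ R₂).symm.toStarAlgHom := by
      refine StarSubalgebra.topologicalClosure_minimal (StarAlgebra.adjoin_le ?_)
        (hcl.preimage (conjEllTwoProd R₁ R₂).symm.toStarAlgHom.continuous_of_cstarAlgebra)
      rintro _ ⟨S, hS, T, hT, rfl⟩
      -- S ⊗ T = (S ⊗ 1)(1 ⊗ T) reduces a general elementary tensor to the two amplifications.
      have h1 := mul_mem (hl S hS) (hr T hT)
      rwa [← map_mul, tensorOperator_mul, mul_one, one_mul] at h1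
    exact h hy

end Reduced

end

theorem mainTheorem4 {R₁ R₂ : Type*} [Ring R₁] [Ring R₂]
    (C₁ : InvariantSetAlgebra R₁) (C₂ : InvariantSetAlgebra R₂) :
    Nonempty (reducedRingCStarAlgebra (C₁.prod C₂) ≃⋆ₐ[ℂ]
      minTensorProduct (reducedRingCStarAlgebra C₁) (reducedRingCStarAlgebra C₂)) ∧
    Nonempty (FullRingCStarAlgebra (C₁.prod C₂) ≃⋆ₐ[ℂ]
      MaxTensorProduct (FullRingCStarAlgebra C₁) (FullRingCStarAlgebra C₂)) :=
  ⟨nonempty_reducedProdEquiv C₁ C₂, ⟨fullProdEquiv C₁ C₂⟩⟩
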